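/- **Setting.** For $L\in\mathbb N$ let $\mathcal V_L=\{0,\dots,L-1\}$ be the sites of the ring (cycle graph) with edges $\{j,(j+1)\bmod L\}$ and graph distance $d_L$. For $N\in\mathbb N$ let $\mathcal V_L^N=\{x\subseteq\mathcal V_L:|x|=N\}$, made into a graph by joining $x$ and $y$ whenever the symmetric difference $x\triangle y$ is an edge of the ring, and let $d_L^N$ be its graph distance. The set of $N$-particle droplets is $$\mathcal V_{L,1}^N=\{c_{L,m}^N: m\in\mathcal V_L\},\qquad c_{L,m}^N=\Big\{j\bmod L:\ m-\big\lfloor\tfrac{N-1}{2}\big\rfloor\le j\le m+\big\lceil\tfrac{N-1}{2}\big\rceil\Big\},$$ and $d_L^N(x,\mathcal V_{L,1}^N)=\min_{c\in\mathcal V_{L,1}^N}d_L^N(x,c)$. For $A\subseteq\mathcal V_L$ let $\mathcal V^n(A)$ be the set of $n$-element subsets of $A$, and let $A^c=\mathcal V_L\setminus A$. For $\theta\in(0,1/16)$ let $M=\lfloor (L-1)/2\rfloor$ and $\Lambda_L=\Lambda_L(\theta)=\{k\in\mathcal V_L: d_L(k,M)<\theta L\}$, with $\lambda_-=\min\Lambda_L$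 and $\lambda_+=\max\Lambda_L$. Let $a_\pm=\lambda_\pm\pm1$ be the sites adjacent to $\Lambda_L$ (taken mod $L$), and let $y_+^n=\{\lambda_+-j:0\le j\le n-1\}$ and $y_-^n=\{\lambda_-+j:0\le j\le n-1\}$. For $y\in\mathcal V^n(\Lambda_L)$ put $$h_L^n(y)=\begin{cases}\min\big\{d_L^{n+1}(y\cup\{a_+\},\mathcal V_{L,1}^{n+1}),\ d_L^{n+1}(y\cup\{a_-\},\mathcal V_{L,1}^{n+1}),\ L^{5/4}\big\}-1,& y\notin\{y_+^n,y_-^n\},\\ 0,& y\in\{y_+^n,y_-^n\}.\end{cases}$$ **Lemma.** For every $\epsilon\in(0,1/16)$ there is $L_0=L_0(\epsilon)>0$ such that for all $\theta\in(\epsilon,1/16)$, all $L\ge L_0$, with $N=\lfloor\epsilon L\rfloor$, all $n\in\mathbb N$ with $N/2<n<N$, all $y\in\mathcal V^n(\Lambda_L(\theta))$ and all $\mu\ge\ln 2$, $$\sum_{\substack{z\in\mathcal V^{N-n}(\Lambda_L^c)\\ y\cup z\notin\mathcal V_{L,1}^N}} e^{-\mu\, d_L^N(y\cup z,\,\mathcal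 V_{L,1}^N)}\ \le\ 333\,e^{-\mu}\,e^{-\mu h_L^n(y)}.$$ -/

import Mathlib

/-- The site `j mod L` of the ring `{0, …, L - 1}`. -/
def site (L : ℕ) [NeZero L] (j : ℤ) : Fin L :=
  ⟨(j % (L : ℤ)).toNat, by
    have h0 : (L : ℤ) ≠ 0 := by exact_mod_cast NeZero.ne L
    have hL : (0 : ℤ) < L := by exact_mod_cast Nat.pos_of_ne_zero (NeZero.ne L)
    have h1 := Int.emod_nonneg j h0
    have h2 := Int.emod_lt_of_pos j hL
    omega⟩

/-- `N`-particle configurations on the ring: `N`-element subsets of the sites. -/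
abbrev Config (L N : ℕ) : Type := {x : Finset (Fin L) // x.card = N}

/-- The graph of `N`-particle configurations: two configurations are adjacent when their symmetric
difference is an edge of the ring, i.e. when they differ by one hop of one particle. -/
def configGraph (L N : ℕ) : SimpleGraph (Config L N) where
  Adj x y := ∃ i j : Fin L, (SimpleGraph.cycleGraph L).Adj i j ∧ symmDiff x.1 y.1 = {i, j}
  symm := ⟨by
    rintro x y ⟨i, j, hij, h⟩
    exact ⟨i, j, hij, by rw [symmDiff_comm]; exact h⟩⟩
  loopless := ⟨by
    rintro x ⟨i, j, -, h⟩
    rw [symmDiff_self] at h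
    have hi : i ∈ ({i, j} : Finset (Fin L)) := by simp
    rw [← h] at hi
    simp at hi⟩

/-- The `N`-particle droplet centred at `m`: the sites `j mod L` with
`m - ⌊(N - 1) / 2⌋ ≤ j ≤ m + ⌈(N - 1) / 2⌉`. Integer division rounds down, and
`⌈(N - 1) / 2⌉ = ⌊N / 2⌋`. -/
noncomputable def droplet (L : ℕ) [NeZero L] (N : ℕ) (m : Fin L) : Finset (Fin L) :=
  (Finset.Icc ((m.val : ℤ) - ((N : ℤ) - 1) / 2) ((m.val : ℤ) + (N : ℤ) / 2)).image (site L)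

/-- The configuration `x` is a droplet (with `|x|` particles). -/
def IsDroplet {L : ℕ} [NeZero L] (x : Finset (Fin L)) : Prop :=
  ∃ m : Fin L, x = droplet L x.card m

noncomputable instance isDropletDecidable {L : ℕ} [NeZero L] (x : Finset (Fin L)) : Decidable (IsDroplet x) :=
  inferInstanceAs (Decidable (∃ m : Fin L, x = droplet L x.card m))

/-- The distance of `x`, in the graph of `|x|`-particle configurations, to the set of `|x|`-particle
droplets. -/
noncomputable def dropletDist {L : ℕ} [NeZero L] (x : Finset (Fin L)) : ℕ :=
  sInf {k : ℕ | ∃ c : Config L x.card, IsDroplet c.1 ∧ k = (configGraph L x.card).dist ⟨x, rfl⟩ c}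

/-- The middle site `⌊(L - 1) / 2⌋` of the ring. -/
def midSite (L : ℕ) [NeZero L] : Fin L :=
  ⟨(L - 1) / 2, by have := Nat.pos_of_ne_zero (NeZero.ne L); omega⟩

open Classical in
/-- The sector `Λ_L(θ)`: all sites at ring distance less than `θ L` from the middle site. -/
noncomputable def sector (L : ℕ) [NeZero L] (θ : ℝ) : Finset (Fin L) :=
  Finset.univ.filter fun k => ((SimpleGraph.cycleGraph L).dist k (midSite L) : ℝ) < θ * L

/-- The smallest site of the sector (which is nonempty when `θ > 0`). -/
noncomputable def sectorMin (L : ℕ) [NeZero L] (θ : ℝ) : Fin L := (sector L θ).inf id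

/-- The largest site of the sector (which is nonempty when `θ > 0`). -/
noncomputable def sectorMax (L : ℕ) [NeZero L] (θ : ℝ) : Fin L := (sector L θ).sup id

theorem sector_nonempty (L : ℕ) [NeZero L] {θ : ℝ} (hθ : 0 < θ) : (sector L θ).Nonempty := by
  refine ⟨midSite L, ?_⟩
  have hL : (0 : ℝ) < L := by exact_mod_cast Nat.pos_of_ne_zero (NeZero.ne L)
  simpa [sector] using mul_pos hθ hL

theorem isLeast_sectorMin (L : ℕ) [NeZero L] {θ : ℝ} (hθ : 0 < θ) :
    IsLeast (sector L θ : Set (Fin L)) (sectorMin L θ) := by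
  have h := sector_nonempty L hθ
  have he : sectorMin L θ = (sector L θ).min' h := by
    rw [sectorMin, Finset.min', Finset.inf'_eq_inf]
  rw [he]
  exact Finset.isLeast_min' _ h

theorem isGreatest_sectorMax (L : ℕ) [NeZero L] {θ : ℝ} (hθ : 0 < θ) :
    IsGreatest (sector L θ : Set (Fin L)) (sectorMax L θ) := by
  have h := sector_nonempty L hθ
  have he : sectorMax L θ = (sector L θ).max' h := by
    rw [sectorMax, Finset.max', Finset.sup'_eq_sup]
  rw [he]
  exact Finset.isGreatest_max' _ h

/-- The site directly to the left of the sector. -/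
noncomputable def leftSite (L : ℕ) [NeZero L] (θ : ℝ) : Fin L :=
  site L (((sectorMin L θ).val : ℤ) - 1)

/-- The site directly to the right of the sector. -/
noncomputable def rightSite (L : ℕ) [NeZero L] (θ : ℝ) : Fin L :=
  site L (((sectorMax L θ).val : ℤ) + 1)

/-- The cluster of the `n` leftmost sites of the sector. -/
noncomputable def leftCluster (L : ℕ) [NeZero L] (θ : ℝ) (n : ℕ) : Finset (Fin L) :=
  (Finset.range n).image fun j : ℕ => site L (((sectorMin L θ).val : ℤ) + (j : ℤ))

/-- The cluster of the `n` rightmost sites of the sector. -/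
noncomputable def rightCluster (L : ℕ) [NeZero L] (θ : ℝ) (n : ℕ) : Finset (Fin L) :=
  (Finset.range n).image fun j : ℕ => site L (((sectorMax L θ).val : ℤ) - (j : ℤ))

/-- The function `h_L^n` on `n`-particle configurations in the sector. -/
noncomputable def hFun (L : ℕ) [NeZero L] (θ : ℝ) (n : ℕ) (y : Finset (Fin L)) : ℝ :=
  if y = rightCluster L θ n ∨ y = leftCluster L θ n then 0
  else
    min (min (dropletDist (y ∪ {rightSite L θ}) : ℝ) (dropletDist (y ∪ {leftSite L θ}) : ℝ))
      ((L : ℝ) ^ (5 / 4 : ℝ)) - 1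

/-!
The distance of an `N`-particle configuration `x` to the droplets has an explicit form. Cut the ring
open at a hole between two particles. To gather the particles of `x` into a droplet without passing
the cut, every hole has to be crossed by all the particles on one of its two sides, and crossing it
from the smaller side is enough. So the distance is the minimum over the cuts of
`∑ min (particles to the left) (particles to the right)`, the sum being over the holes. In terms of
the counting function `before x`, the number of particles to the left of a hole modulo `N`, the cut
before the particle number `s` costs `cutCost x s = ∑ dist (before x v - s, N ℤ)`. This expression
changes by at most one when a particle hops (up to a shift of `s` when it hops through the site where
the counting begins), which gives the lower bound `exists_cutCost_le_dropletDist`. The upper bound is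
needed for the cut `s = 0` only, see `dropletDist_le_cutCost_zero`.

For `x = y ∪ z` with `y` in the sector `Λ`, `n = |y|`, and `z` outside of it, `k = |z| < n`, the cost
splits into contributions of the holes in `Λ` and of the outer holes (`cutCost_union`). There are two
kinds of cuts.

* If the cut is between outer particles, so that `r` of them are to the right of `Λ` before the cut
  and `k - r` to the left, then the outer holes cost `∑ |l - r|`, where `l` is the number of outer
  particles preceding the hole. The generating function of this quantity over all `z` is at most a
  product of two partition functions, so at most `16` at `1 / 2` (`holeGen_dist_le_sixteen`). The
  holes in `Λ` cost at least as much as for a single outer particle next to `Λ`, and at least one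
  more per hole unless `r = 0`, `r = k` or `r = 1`, `k = 2` (`le_of_cut_outside`). So three values of
  `r` contribute a constant and the others are exponentially suppressed.
* If the cut is between particles of `y`, then each of the many outer holes is crossed
  (`le_of_cut_inside`), and this outweighs the number `choose m k` of all the configurations `z`
  (`choose_le_two_pow`), since there are few outer particles.

In both cases the exponent exceeds a number `T ≥ h + 1` (`IsExponentBound`), so that
`exp (-μ) ^ T` can be split off and the rest is largest for `exp (-μ) = 1 / 2`.
-/

/-! ### Cutting the ring open -/

/-- The distance of the integer `t` to the nearest multiple of `N`. -/
def circDist (N t : ℤ) : ℤ := min (t % N) (N - t % N)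

theorem circDist_add_self (N t : ℤ) : circDist N (t + N) = circDist N t := by
  simp [circDist]

theorem circDist_of_nonneg_of_le {N t : ℤ} (h0 : 0 ≤ t) (h1 : t ≤ N) :
    circDist N t = min t (N - t) := by
  rcases h1.lt_or_eq with h | rfl
  · rw [circDist, Int.emod_eq_of_lt h0 h]
  · simp [circDist, h0]

theorem circDist_of_nonpos_of_le {N t : ℤ} (h0 : t ≤ 0) (h1 : -N ≤ t) :
    circDist N t = min (-t) (N + t) := by
  rw [← circDist_add_self, circDist_of_nonneg_of_le (by omega) (by omega)]
  omega

theorem circDist_nonneg {N : ℤ} (hN : 0 < N) (t : ℤ) : 0 ≤ circDist N t := by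
  have h0 := Int.emod_nonneg t hN.ne'
  have h1 := Int.emod_lt_of_pos t hN
  simp only [circDist]
  omega

theorem abs_circDist_add_one_sub_le {N : ℤ} (hN : 0 < N) (t : ℤ) :
    |circDist N (t + 1) - circDist N t| ≤ 1 := by
  have h0 := Int.emod_nonneg t hN.ne'
  have h1 := Int.emod_lt_of_pos t hN
  have h2 : circDist N (t + 1) = circDist N (t % N + 1) := by
    simp [circDist]
  rw [h2, circDist_of_nonneg_of_le (by omega) (by omega), circDist, abs_le]
  omega

/-- The number of particles of `x` strictly to the left of the site `v`, when the ring is cut open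
at the site `0`. -/
def before {L : ℕ} (x : Finset (Fin L)) (v : Fin L) : ℕ := (x.filter (· < v)).card

/-- The cost of gathering the particles of `x` into a droplet when the ring is cut open between the
particles number `s - 1` and `s`: a hole has to be crossed by all the particles on the smaller one
of its two sides, so it contributes the distance of `before x v - s` to the multiples of the
particle number. -/
def cutCost {L : ℕ} (x : Finset (Fin L)) (s : ℤ) : ℤ :=
  ∑ v ∈ xᶜ, circDist x.card (before x v - s)

section Hop

variable {L : ℕ} {x : Finset (Fin L)} {u w : Fin L}

theorem before_eq_sum (x : Finset (Fin L)) (v : Fin L) :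
    before x v = ∑ a ∈ x, if a < v then 1 else 0 := by
  rw [before, Finset.card_filter]

theorem before_insert_erase (hu : u ∈ x) (hw : w ∉ x) (v : Fin L) :
    before (insert w (x.erase u)) v + (if u < v then 1 else 0)
      = before x v + (if w < v then 1 else 0) := by
  have hw' : w ∉ x.erase u := fun h => hw (Finset.mem_of_mem_erase h)
  rw [before_eq_sum, before_eq_sum, Finset.sum_insert hw', ← Finset.add_sum_erase x _ hu]
  ring

theorem compl_insert_erase (hu : u ∈ x) (hw : w ∉ x) :
    (insert w (x.erase u))ᶜ = insert u (xᶜ.erase w) := by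
  ext v
  simp only [Finset.mem_compl, Finset.mem_insert, Finset.mem_erase]
  have : u ≠ w := fun h => hw (h ▸ hu)
  grind

theorem card_insert_erase (hu : u ∈ x) (hw : w ∉ x) : (insert w (x.erase u)).card = x.card := by
  rw [Finset.card_insert_of_notMem (fun h => hw (Finset.mem_of_mem_erase h)),
    Finset.card_erase_add_one hu]

/-- Moving a particle from `u` to the empty site `w` turns the hole `w` into the hole `u`. -/
theorem cutCost_insert_erase (hu : u ∈ x) (hw : w ∉ x) (s : ℤ) :
    cutCost (insert w (x.erase u)) s
      = circDist x.card (before (insert w (x.erase u)) u - s)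
        + ∑ v ∈ xᶜ.erase w, circDist x.card (before (insert w (x.erase u)) v - s) := by
  rw [cutCost, compl_insert_erase hu hw, card_insert_erase hu hw, Finset.sum_insert]
  simp [hu]

theorem cutCost_eq_add_erase (hw : w ∉ x) (s : ℤ) :
    cutCost x s = circDist x.card (before x w - s)
        + ∑ v ∈ xᶜ.erase w, circDist x.card (before x v - s) := by
  exact (Finset.add_sum_erase xᶜ (fun v => circDist x.card (before x v - s))
    (Finset.mem_compl.2 hw)).symm

/-- A hop to the right, away from the cut of the ring at `0`, only changes the contribution of the
hole that is exchanged with the particle. -/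
theorem cutCost_hop (hu : u ∈ x) (hw : w ∉ x) (huw : u.val + 1 = w.val) (s : ℤ) :
    cutCost (insert w (x.erase u)) s - cutCost x s
      = circDist x.card (before x w - 1 - s) - circDist x.card (before x w - s) := by
  rw [cutCost_insert_erase hu hw, cutCost_eq_add_erase hw]
  have h1 : ((before (insert w (x.erase u)) u : ℕ) : ℤ) = before x w - 1 := by
    have h := before_insert_erase hu hw w
    have h' : before (insert w (x.erase u)) u = before (insert w (x.erase u)) w := by
      rw [before, before]
      congr 1
      ext a
      simp only [Finset.mem_filter, Finset.mem_insert, Finset.mem_erase, Fin.lt_def]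
      have : a ≠ u → a.val ≠ u.val := fun h h' => h (Fin.ext h')
      have : a = w → a.val = w.val := fun h => h ▸ rfl
      grind
    rw [if_pos (by rw [Fin.lt_def]; omega), if_neg (lt_irrefl _)] at h
    omega
  have h2 : ∀ v ∈ xᶜ.erase w, before (insert w (x.erase u)) v = before x v := by
    intro v hv
    have h := before_insert_erase hu hw v
    simp only [Finset.mem_erase, Finset.mem_compl] at hv
    have hvu : v.val ≠ u.val := fun h => hv.2 (Fin.ext h ▸ hu)
    have hvw : v.val ≠ w.val := fun h => hv.1 (Fin.ext h)
    simp only [Fin.lt_def] at h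
    split_ifs at h <;> omega
  rw [h1, Finset.sum_congr rfl fun v hv => by rw [h2 v hv]]
  ring

theorem abs_cutCost_hop_sub_le (hu : u ∈ x) (hw : w ∉ x) (huw : u.val + 1 = w.val) (s : ℤ) :
    |cutCost (insert w (x.erase u)) s - cutCost x s| ≤ 1 := by
  have hN : (0 : ℤ) < x.card := by exact_mod_cast Finset.card_pos.2 ⟨u, hu⟩
  have h := abs_circDist_add_one_sub_le hN (before x w - 1 - s)
  rw [cutCost_hop hu hw huw, abs_sub_comm]
  convert h using 4
  ring

/-- A hop from the last site to the first one passes the cut of the ring at `0`, which renumbers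
the particles. -/
theorem abs_cutCost_wrap_sub_le (hu : u ∈ x) (hw : w ∉ x) (hu' : u.val + 1 = L)
    (hw' : w.val = 0) (s : ℤ) :
    |cutCost (insert w (x.erase u)) (s + 1) - cutCost x s| ≤ 1 := by
  have hN : (0 : ℤ) < x.card := by exact_mod_cast Finset.card_pos.2 ⟨u, hu⟩
  rw [cutCost_insert_erase hu hw, cutCost_eq_add_erase hw]
  have h0 : before x w = 0 := by
    rw [before, Finset.card_eq_zero, Finset.filter_eq_empty_iff]
    intro a _
    rw [Fin.lt_def]
    omega
  have h1 : before (insert w (x.erase u)) u = x.card := by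
    rw [before, ← card_insert_erase hu hw]
    congr 1
    rw [Finset.filter_eq_self]
    intro a ha
    have hau : a ≠ u := by
      rintro rfl
      simp only [Finset.mem_insert, Finset.mem_erase] at ha
      rcases ha with rfl | ha
      · exact hw hu
      · exact ha.1 rfl
    have := a.2
    have : a.val ≠ u.val := fun h => hau (Fin.ext h)
    rw [Fin.lt_def]
    omega
  have h2 : ∀ v ∈ xᶜ.erase w,
      ((before (insert w (x.erase u)) v : ℕ) : ℤ) - (s + 1) = before x v - s := by
    intro v hv
    have h := before_insert_erase hu hw v
    simp only [Finset.mem_erase, Finset.mem_compl] at hv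
    have hvu : v.val ≠ u.val := fun h => hv.2 (Fin.ext h ▸ hu)
    have hvw : v.val ≠ w.val := fun h => hv.1 (Fin.ext h)
    have := v.2
    simp only [Fin.lt_def] at h
    split_ifs at h <;> omega
  rw [h0, h1, Finset.sum_congr rfl fun v hv => by rw [h2 v hv]]
  have h := abs_circDist_add_one_sub_le hN (-s - 1)
  have e1 : ((x.card : ℕ) : ℤ) - (s + 1) = (-s - 1) + x.card := by ring
  rw [e1, circDist_add_self, add_sub_add_right_eq_sub, abs_sub_comm]
  convert h using 4
  push_cast
  ring

end Hop

theorem cycleGraph_adj_iff_val {L : ℕ} (hL : 3 ≤ L) (i j : Fin L) :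
    (SimpleGraph.cycleGraph L).Adj i j ↔
      i.val + 1 = j.val ∨ j.val + 1 = i.val ∨ (i.val + 1 = L ∧ j.val = 0)
        ∨ (j.val + 1 = L ∧ i.val = 0) := by
  obtain ⟨k, rfl⟩ : ∃ k, L = k + 3 := ⟨L - 3, by omega⟩
  have h1 : ∀ a b : Fin (k + 3),
      (a - b).val = if b.val ≤ a.val then a.val - b.val else k + 3 + a.val - b.val := by
    intro a b
    split_ifs with h
    · exact Fin.sub_val_of_le h
    · exact Fin.coe_sub_iff_lt.2 (Fin.lt_def.2 (not_le.1 h))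
  rw [SimpleGraph.cycleGraph_adj', h1, h1]
  have := i.2
  have := j.2
  split_ifs <;> omega

theorem configGraph_adj_insert_erase {L N : ℕ} {x x' : Config L N} {u w : Fin L} (hu : u ∈ x.1)
    (hw : w ∉ x.1) (h : x'.1 = insert w (x.1.erase u))
    (huw : (SimpleGraph.cycleGraph L).Adj u w) : (configGraph L N).Adj x x' := by
  refine ⟨u, w, huw, ?_⟩
  have : u ≠ w := fun h => hw (h ▸ hu)
  ext v
  simp only [h, Finset.mem_symmDiff, Finset.mem_insert, Finset.mem_erase, Finset.mem_singleton]
  grind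

theorem exists_insert_erase_of_configGraph_adj {L N : ℕ} {x x' : Config L N}
    (h : (configGraph L N).Adj x x') :
    ∃ u w, u ∈ x.1 ∧ w ∉ x.1 ∧ x'.1 = insert w (x.1.erase u) ∧
      (SimpleGraph.cycleGraph L).Adj u w := by
  obtain ⟨i, j, hij, hs⟩ := h
  have hne := hij.ne
  have hc : (x.1 \ x'.1).card = (x'.1 \ x.1).card :=
    Finset.card_sdiff_comm (x.2.trans x'.2.symm)
  have hd : Disjoint (x.1 \ x'.1) (x'.1 \ x.1) := disjoint_sdiff_sdiff
  have h2 : (x.1 \ x'.1).card + (x'.1 \ x.1).card = 2 := by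
    rw [← Finset.card_union_of_disjoint hd, ← Finset.card_pair hne, ← hs]
    rfl
  obtain ⟨a, ha⟩ := Finset.card_eq_one.1 (show (x.1 \ x'.1).card = 1 by omega)
  obtain ⟨b, hb⟩ := Finset.card_eq_one.1 (show (x'.1 \ x.1).card = 1 by omega)
  have ha' : ∀ v, (v ∈ x.1 ∧ v ∉ x'.1) ↔ v = a := fun v => by
    rw [← Finset.mem_sdiff, ha, Finset.mem_singleton]
  have hb' : ∀ v, (v ∈ x'.1 ∧ v ∉ x.1) ↔ v = b := fun v => by
    rw [← Finset.mem_sdiff, hb, Finset.mem_singleton]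
  have hs' : ∀ v, (v = a ∨ v = b) ↔ (v = i ∨ v = j) := fun v => by
    have : v ∈ symmDiff x.1 x'.1 ↔ v = i ∨ v = j := by rw [hs]; simp
    rw [← this, Finset.mem_symmDiff, ha', hb']
  refine ⟨a, b, ((ha' a).2 rfl).1, ((hb' b).2 rfl).2, ?_, ?_⟩
  · ext v
    simp only [Finset.mem_insert, Finset.mem_erase]
    have := ha' v
    have := hb' v
    grind
  · have hab : a ≠ b := fun h => by
      have h1 := (ha' a).2 rfl
      have h2 := (hb' b).2 rfl
      rw [← h] at h2
      exact h2.2 h1.1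
    have h1 := (hs' a).1 (Or.inl rfl)
    have h2 := (hs' b).1 (Or.inr rfl)
    have := hij.symm
    rcases h1 with rfl | rfl <;> rcases h2 with rfl | rfl <;> first | assumption | exact absurd rfl hab

/-- The least cost over all cuts is a Lipschitz function on the configuration graph. -/
theorem exists_cutCost_le_of_adj {L N : ℕ} (hL : 3 ≤ L) {x x' : Config L N}
    (h : (configGraph L N).Adj x x') (s : ℤ) :
    ∃ s', cutCost x.1 s' ≤ cutCost x'.1 s + 1 := by
  obtain ⟨u, w, hu, hw, hx', huw⟩ := exists_insert_erase_of_configGraph_adj h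
  have hne : u ≠ w := huw.ne
  have hu' : u ∉ x'.1 := by simp [hx', hne]
  have hw' : w ∈ x'.1 := by simp [hx']
  have hx : x.1 = insert u (x'.1.erase w) := by
    ext v
    simp only [hx', Finset.mem_insert, Finset.mem_erase]
    grind
  rcases (cycleGraph_adj_iff_val hL u w).1 huw with h1 | h1 | h1 | h1
  · refine ⟨s, ?_⟩
    have := abs_le.1 (abs_cutCost_hop_sub_le hu hw h1 s)
    rw [← hx'] at this
    linarith
  · refine ⟨s, ?_⟩
    have := abs_le.1 (abs_cutCost_hop_sub_le hw' hu' h1 s)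
    rw [← hx] at this
    linarith
  · refine ⟨s - 1, ?_⟩
    have := abs_le.1 (abs_cutCost_wrap_sub_le hu hw h1.1 h1.2 (s - 1))
    rw [← hx', sub_add_cancel] at this
    linarith
  · refine ⟨s + 1, ?_⟩
    have := abs_le.1 (abs_cutCost_wrap_sub_le hw' hu' h1.1 h1.2 s)
    rw [← hx] at this
    linarith

/-! ### Distances to droplets -/

section Droplet

theorem before_le_card {L : ℕ} (x : Finset (Fin L)) (v : Fin L) : before x v ≤ x.card :=
  Finset.card_filter_le _ _

variable {L : ℕ} [NeZero L]

theorem cutCost_zero_eq {L : ℕ} (x : Finset (Fin L)) :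
    cutCost x 0 = ∑ v ∈ xᶜ, min (before x v : ℤ) (x.card - before x v) := by
  refine Finset.sum_congr rfl fun v _ => ?_
  have := before_le_card x v
  rw [sub_zero, circDist_of_nonneg_of_le (by omega) (by omega)]

theorem site_eq_iff (j : ℤ) (v : Fin L) : site L j = v ↔ j % (L : ℤ) = v.val := by
  have h0 : (L : ℤ) ≠ 0 := by exact_mod_cast NeZero.ne L
  have h1 := Int.emod_nonneg j h0
  rw [Fin.ext_iff, site]
  simp only
  omega

/-- The sites of a droplet: the window of integers that defines it meets at most two neighbouring
periods of the ring. -/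
theorem mem_droplet_iff {N : ℕ} (hNL : N ≤ L) (m v : Fin L) :
    v ∈ droplet L N m ↔ ∃ t : ℤ, (t = 0 ∨ t = L ∨ t = -L) ∧
      (m.val : ℤ) - ((N : ℤ) - 1) / 2 ≤ v.val + t ∧ (v.val : ℤ) + t ≤ m.val + (N : ℤ) / 2 := by
  have hm := m.2
  have hv := v.2
  simp only [droplet, Finset.mem_image, Finset.mem_Icc, site_eq_iff]
  constructor
  · rintro ⟨j, ⟨h1, h2⟩, h3⟩
    have h4 := Int.emod_add_mul_ediv j L
    rw [h3] at h4
    have h5 : j / (L : ℤ) < 2 := by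
      by_contra! h
      have := mul_le_mul_of_nonneg_left h (Int.natCast_nonneg L)
      omega
    have h6 : -2 < j / (L : ℤ) := by
      by_contra! h
      have := mul_le_mul_of_nonneg_left h (Int.natCast_nonneg L)
      omega
    refine ⟨L * (j / L), ?_, by omega, by omega⟩
    have : j / (L : ℤ) = 0 ∨ j / (L : ℤ) = 1 ∨ j / (L : ℤ) = -1 := by omega
    rcases this with h | h | h <;> simp [h]
  · rintro ⟨t, ht, h1, h2⟩
    refine ⟨v.val + t, ⟨h1, h2⟩, ?_⟩
    have : ((v.val : ℤ) + t) % L = (v.val : ℤ) % L := by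
      rcases ht with rfl | rfl | rfl
      · simp
      · simp
      · rw [← sub_eq_add_neg, Int.sub_emod_right]
    rw [this, Int.emod_eq_of_lt (by omega) (by omega)]

theorem isDroplet_of_mem_iff {x : Finset (Fin L)} (hx : 0 < x.card) {b : ℕ}
    (hb : b + x.card ≤ L) (h : ∀ v : Fin L, v ∈ x ↔ b ≤ v.val ∧ v.val < b + x.card) :
    IsDroplet x := by
  refine ⟨⟨b + (x.card - 1) / 2, by omega⟩, ?_⟩
  ext v
  have := v.2
  rw [h, mem_droplet_iff (by omega)]
  constructor
  · rintro ⟨h1, h2⟩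
    exact ⟨0, Or.inl rfl, by simp only; omega, by simp only; omega⟩
  · rintro ⟨t, ht, h1, h2⟩
    simp only at h1 h2
    omega

/-- A droplet costs nothing if the ring is cut open in its complement. -/
theorem IsDroplet.exists_cutCost_eq_zero {x : Finset (Fin L)} (h : IsDroplet x)
    (hx : 0 < x.card) : ∃ s, cutCost x s = 0 := by
  have hxL : x.card ≤ L := by simpa using Finset.card_le_univ x
  obtain ⟨m, hm⟩ := h
  have hN : (0 : ℤ) < x.card := by exact_mod_cast hx
  have hmem := mem_droplet_iff hxL m
  rw [← hm] at hmem
  have hmL := m.2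
  have key : ∃ s : ℕ, ∀ v ∉ x, before x v = s ∨ (s = 0 ∧ before x v = x.card) := by
    by_cases h1 : (0 : ℤ) ≤ (m.val : ℤ) - ((x.card : ℤ) - 1) / 2 ∧
        (m.val : ℤ) + (x.card : ℤ) / 2 < L
    · refine ⟨0, fun v hv => ?_⟩
      have hv' := mt (hmem v).2 hv
      simp only [not_exists, not_and, not_le] at hv'
      have hv0 := hv' 0 (Or.inl rfl)
      have := v.2
      by_cases h2 : (v.val : ℤ) < (m.val : ℤ) - ((x.card : ℤ) - 1) / 2
      · left
        rw [before, Finset.card_eq_zero, Finset.filter_eq_empty_iff]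
        intro a ha
        obtain ⟨t, ht, ht'⟩ := (hmem a).1 ha
        have := a.2
        rw [Fin.lt_def]
        omega
      · right
        refine ⟨rfl, ?_⟩
        rw [before, Finset.filter_true_of_mem]
        intro a ha
        obtain ⟨t, ht, ht'⟩ := (hmem a).1 ha
        have := a.2
        rw [Fin.lt_def]
        omega
    · obtain ⟨c, hc⟩ : ∃ c : ℤ, ∀ v : Fin L, v ∈ x ↔ (v.val : ℤ) < c ∨ c + L - x.card ≤ v.val := by
        by_cases h2 : (m.val : ℤ) - ((x.card : ℤ) - 1) / 2 < 0
        · refine ⟨m.val + (x.card : ℤ) / 2 + 1, fun v => ?_⟩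
          have := v.2
          rw [hmem]
          constructor
          · rintro ⟨t, ht, ht'⟩
            omega
          · rintro (h | h)
            · exact ⟨0, by omega, by omega⟩
            · exact ⟨-L, by omega, by omega⟩
        · refine ⟨m.val + (x.card : ℤ) / 2 + 1 - L, fun v => ?_⟩
          have := v.2
          rw [hmem]
          constructor
          · rintro ⟨t, ht, ht'⟩
            omega
          · rintro (h | h)
            · exact ⟨L, by omega, by omega⟩
            · exact ⟨0, by omega, by omega⟩
      refine ⟨(x.filter fun a => (a.val : ℤ) < c).card, fun v hv => Or.inl ?_⟩
      rw [before]
      congr 1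
      apply Finset.filter_congr
      intro a ha
      have := (hc a).1 ha
      have := mt (hc v).2 hv
      rw [Fin.lt_def]
      omega
  obtain ⟨s, hs⟩ := key
  refine ⟨s, Finset.sum_eq_zero fun v hv => ?_⟩
  rcases hs v (Finset.mem_compl.1 hv) with h | ⟨h, h'⟩
  · rw [h, circDist_of_nonneg_of_le (by omega) (by omega)]
    omega
  · rw [h', h, circDist_of_nonneg_of_le (by omega) (by omega)]
    omega

/-- Without holes between particles, a configuration is a droplet. -/
theorem isDroplet_of_cutCost_zero_le {x : Finset (Fin L)} (hx : x.Nonempty)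
    (h : cutCost x 0 ≤ 0) : IsDroplet x := by
  have hnn : ∀ v ∈ xᶜ, 0 ≤ min (before x v : ℤ) (x.card - before x v) := fun v _ => by
    have := before_le_card x v
    omega
  rw [cutCost_zero_eq] at h
  have h0 := (Finset.sum_eq_zero_iff_of_nonneg hnn).1 (le_antisymm h (Finset.sum_nonneg hnn))
  have hI : x = Finset.Icc (x.min' hx) (x.max' hx) := by
    ext v
    rw [Finset.mem_Icc]
    refine ⟨fun hv => ⟨Finset.min'_le _ _ hv, Finset.le_max' _ _ hv⟩, fun ⟨h1, h2⟩ => ?_⟩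
    by_contra hv
    have hm := h0 v (Finset.mem_compl.2 hv)
    have e1 : before x v ≠ 0 := by
      rw [before, Finset.card_ne_zero]
      exact ⟨x.min' hx, Finset.mem_filter.2 ⟨Finset.min'_mem _ _,
        lt_of_le_of_ne h1 fun h => hv (h ▸ Finset.min'_mem _ _)⟩⟩
    have e2 : before x v < x.card := by
      apply Finset.card_lt_card
      rw [Finset.filter_ssubset]
      exact ⟨x.max' hx, Finset.max'_mem _ _, not_lt.2 h2⟩
    omega
  have hle : x.min' hx ≤ x.max' hx := Finset.min'_le _ _ (Finset.max'_mem _ _)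
  have hc : x.card = (x.max' hx).val + 1 - (x.min' hx).val := by
    conv_lhs => rw [hI]
    exact Fin.card_Icc _ _
  have := (x.max' hx).2
  rw [Fin.le_def] at hle
  refine isDroplet_of_mem_iff (b := (x.min' hx).val) (Finset.card_pos.2 hx) (by omega) fun v => ?_
  conv_lhs => rw [hI]
  rw [Finset.mem_Icc, Fin.le_def, Fin.le_def]
  omega

omit [NeZero L] in
/-- As long as there is a hole between particles, the cost can be lowered by letting a particle next
to it hop away from the shorter side. -/
theorem exists_adj_cutCost_lt (hL : 3 ≤ L) {N : ℕ} (x : Config L N) (h : 0 < cutCost x.1 0) :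
    ∃ x' : Config L N, (configGraph L N).Adj x x' ∧ cutCost x'.1 0 + 1 = cutCost x.1 0 := by
  rw [cutCost_zero_eq] at h
  obtain ⟨v, hv, hpos⟩ := Finset.exists_lt_of_sum_lt (f := fun _ => (0 : ℤ)) (by simpa using h)
  have hv := Finset.mem_compl.1 hv
  by_cases hc : (before x.1 v : ℤ) ≤ x.1.card - before x.1 v
  · have hne : (x.1.filter (· < v)).Nonempty := by
      rw [← Finset.card_pos]
      change 0 < before x.1 v
      omega
    set u := (x.1.filter (· < v)).max' hne with hu_def
    obtain ⟨hu, huv⟩ := Finset.mem_filter.1 (Finset.max'_mem _ hne)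
    rw [← hu_def] at hu huv
    have hmax : ∀ a ∈ x.1, a < v → a.val ≤ u.val := fun a ha hav =>
      Finset.le_max' _ _ (Finset.mem_filter.2 ⟨ha, hav⟩)
    rw [Fin.lt_def] at huv
    obtain ⟨w, hw⟩ : ∃ w : Fin L, u.val + 1 = w.val := ⟨⟨u.val + 1, by omega⟩, rfl⟩
    have hwx : w ∉ x.1 := by
      intro hwx
      rcases lt_or_eq_of_le (show w.val ≤ v.val by omega) with h | h
      · have := hmax w hwx h
        omega
      · exact hv (Fin.ext h ▸ hwx)
    have hbw : before x.1 w = before x.1 v := by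
      rw [before, before]
      congr 1
      refine Finset.filter_congr fun a ha => ?_
      have := hmax a ha
      simp only [Fin.lt_def] at this ⊢
      omega
    refine ⟨⟨insert w (x.1.erase u), (card_insert_erase hu hwx).trans x.2⟩,
      configGraph_adj_insert_erase hu hwx rfl
        ((cycleGraph_adj_iff_val hL u w).2 (Or.inl hw)), ?_⟩
    have hh := cutCost_hop hu hwx hw 0
    have := before_le_card x.1 v
    rw [hbw, circDist_of_nonneg_of_le (by omega) (by omega),
      circDist_of_nonneg_of_le (by omega) (by omega)] at hh
    simp only
    omega
  · have hne : (x.1.filter (v < ·)).Nonempty := by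
      by_contra hne
      rw [Finset.not_nonempty_iff_eq_empty, Finset.filter_eq_empty_iff] at hne
      have : before x.1 v = x.1.card := by
        rw [before, Finset.filter_true_of_mem]
        intro a ha
        exact lt_of_le_of_ne (not_lt.1 (hne ha)) fun h => hv (h ▸ ha)
      omega
    set u := (x.1.filter (v < ·)).min' hne with hu_def
    obtain ⟨hu, huv⟩ := Finset.mem_filter.1 (Finset.min'_mem _ hne)
    rw [← hu_def] at hu huv
    have hmin : ∀ a ∈ x.1, v < a → u.val ≤ a.val := fun a ha hav =>
      Finset.min'_le _ _ (Finset.mem_filter.2 ⟨ha, hav⟩)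
    rw [Fin.lt_def] at huv
    obtain ⟨w, hw⟩ : ∃ w : Fin L, w.val + 1 = u.val := ⟨⟨u.val - 1, by omega⟩, by simp only; omega⟩
    have hwx : w ∉ x.1 := by
      intro hwx
      rcases lt_or_eq_of_le (show v.val ≤ w.val by omega) with h | h
      · have := hmin w hwx h
        omega
      · exact hv (Fin.ext h ▸ hwx)
    have hbu : before x.1 u = before x.1 v := by
      rw [before, before]
      congr 1
      refine Finset.filter_congr fun a ha => ?_
      have := hmin a ha
      have : a.val ≠ v.val := fun h => hv (Fin.ext h ▸ ha)
      simp only [Fin.lt_def] at *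
      omega
    refine ⟨⟨insert w (x.1.erase u), (card_insert_erase hu hwx).trans x.2⟩,
      configGraph_adj_insert_erase hu hwx rfl
        ((cycleGraph_adj_iff_val hL u w).2 (Or.inr (Or.inl hw))), ?_⟩
    have hwu : w ≠ u := fun h => hwx (h ▸ hu)
    have hux' : u ∉ insert w (x.1.erase u) := by simp [hwu.symm]
    have hx : insert u ((insert w (x.1.erase u)).erase w) = x.1 := by
      ext v
      simp only [Finset.mem_insert, Finset.mem_erase]
      grind
    have hh := cutCost_hop (Finset.mem_insert_self w _) hux' hw 0
    have hb := before_insert_erase hu hwx u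
    rw [if_neg (lt_irrefl _), if_pos (by rw [Fin.lt_def]; omega), hbu] at hb
    have hcard := card_insert_erase hu hwx
    have := before_le_card x.1 v
    rw [hx, hcard, circDist_of_nonneg_of_le (by omega) (by omega),
      circDist_of_nonneg_of_le (by omega) (by omega)] at hh
    simp only
    omega

theorem exists_walk_droplet (hL : 3 ≤ L) {N : ℕ} (hN : 0 < N) (j : ℕ) :
    ∀ x : Config L N, cutCost x.1 0 = j →
      ∃ c : Config L N, IsDroplet c.1 ∧ ∃ p : (configGraph L N).Walk x c, p.length = j := by
  induction j with
  | zero =>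
    intro x hx
    refine ⟨x, isDroplet_of_cutCost_zero_le ?_ (by simp [hx]), .nil, rfl⟩
    rw [← Finset.card_pos, x.2]
    exact hN
  | succ j ih =>
    intro x hx
    obtain ⟨x', hadj, hx'⟩ := exists_adj_cutCost_lt hL x (by rw [hx]; positivity)
    obtain ⟨c, hc, p, hp⟩ := ih x' (by push_cast at hx; linarith)
    exact ⟨c, hc, .cons hadj p, by simp [hp]⟩

omit [NeZero L] in
/-- Every configuration can be swept to the left until its particles fill an initial segment. -/
theorem configGraph_preconnected (hL : 3 ≤ L) (N : ℕ) : (configGraph L N).Preconnected := by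
  have key : ∀ (k : ℕ) (x : Config L N), ∑ v ∈ x.1, v.val = k →
      ∃ c : Config L N, IsLowerSet (c.1 : Set (Fin L)) ∧ (configGraph L N).Reachable x c := by
    intro k
    induction k using Nat.strong_induction_on with
    | _ k ih =>
      intro x hx
      by_cases hlow : ∀ w u : Fin L, w.val + 1 = u.val → u ∈ x.1 → w ∈ x.1
      · refine ⟨x, ?_, .rfl⟩
        have hdown : ∀ (d : ℕ) (w u : Fin L), w.val + d = u.val → u ∈ x.1 → w ∈ x.1 := by
          intro d
          induction d with
          | zero => exact fun w u h hu => Fin.ext h ▸ hu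
          | succ d ihd =>
            intro w u h hu
            exact hlow w ⟨w.val + 1, by omega⟩ rfl (ihd _ u (by simp only; omega) hu)
        intro u w hwu hu
        rw [Fin.le_def] at hwu
        exact hdown (u.val - w.val) w u (by omega) hu
      · push Not at hlow
        obtain ⟨w, u, hwu, hu, hw⟩ := hlow
        have hw' : w ∉ x.1.erase u := fun h => hw (Finset.mem_of_mem_erase h)
        have hs : ∑ v ∈ insert w (x.1.erase u), v.val < k := by
          rw [Finset.sum_insert hw']
          have := Finset.add_sum_erase x.1 (fun v : Fin L => v.val) hu
          omega
        obtain ⟨c, hc, hr⟩ := ih _ hs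
          ⟨insert w (x.1.erase u), (card_insert_erase hu hw).trans x.2⟩ rfl
        refine ⟨c, hc, SimpleGraph.Reachable.trans (SimpleGraph.Adj.reachable ?_) hr⟩
        exact configGraph_adj_insert_erase hu hw rfl
          ((cycleGraph_adj_iff_val hL u w).2 (Or.inr (Or.inl hwu)))
  intro x x'
  obtain ⟨c, hc, hr⟩ := key _ x rfl
  obtain ⟨c', hc', hr'⟩ := key _ x' rfl
  have : c = c' := by
    apply Subtype.ext
    rcases hc.total hc' with h | h
    · exact Finset.eq_of_subset_of_card_le (by exact_mod_cast h) (by rw [c.2, c'.2])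
    · exact (Finset.eq_of_subset_of_card_le (by exact_mod_cast h) (by rw [c.2, c'.2])).symm
  exact hr.trans (this ▸ hr'.symm)

theorem dropletDist_le_cutCost_zero (hL : 3 ≤ L) {x : Finset (Fin L)} (hx : x.Nonempty) :
    (dropletDist x : ℤ) ≤ cutCost x 0 := by
  have hnn : 0 ≤ cutCost x 0 := Finset.sum_nonneg fun v _ =>
    circDist_nonneg (by exact_mod_cast Finset.card_pos.2 hx) _
  obtain ⟨j, hj⟩ := Int.eq_ofNat_of_zero_le hnn
  obtain ⟨c, hc, p, hp⟩ := exists_walk_droplet hL (Finset.card_pos.2 hx) j ⟨x, rfl⟩ hj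
  rw [hj]
  have h1 : dropletDist x ≤ (configGraph L x.card).dist ⟨x, rfl⟩ c := Nat.sInf_le ⟨c, hc, rfl⟩
  have h2 := SimpleGraph.dist_le p
  exact_mod_cast h1.trans (h2.trans hp.le)

theorem exists_walk_length_eq_dropletDist (hL : 3 ≤ L) {x : Finset (Fin L)} (hx : x.Nonempty) :
    ∃ c : Config L x.card, IsDroplet c.1 ∧
      ∃ p : (configGraph L x.card).Walk ⟨x, rfl⟩ c, p.length = dropletDist x := by
  have hnn : 0 ≤ cutCost x 0 := Finset.sum_nonneg fun v _ =>
    circDist_nonneg (by exact_mod_cast Finset.card_pos.2 hx) _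
  obtain ⟨j, hj⟩ := Int.eq_ofNat_of_zero_le hnn
  obtain ⟨c, hc, -⟩ := exists_walk_droplet hL (Finset.card_pos.2 hx) j ⟨x, rfl⟩ hj
  obtain ⟨c, hc, hd⟩ := Nat.sInf_mem (s := {k : ℕ | ∃ c : Config L x.card, IsDroplet c.1 ∧
    k = (configGraph L x.card).dist ⟨x, rfl⟩ c}) ⟨_, c, hc, rfl⟩
  obtain ⟨p, hp⟩ := (configGraph_preconnected hL x.card ⟨x, rfl⟩ c).exists_walk_length_eq_dist
  exact ⟨c, hc, p, hp.trans hd.symm⟩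

theorem exists_cutCost_le_length (hL : 3 ≤ L) {N : ℕ} (hN : 0 < N) {x c : Config L N}
    (p : (configGraph L N).Walk x c) (hc : IsDroplet c.1) : ∃ s, cutCost x.1 s ≤ p.length := by
  induction p with
  | @nil x =>
    obtain ⟨s, hs⟩ := hc.exists_cutCost_eq_zero (by rw [x.2]; exact hN)
    exact ⟨s, by simp [hs]⟩
  | cons hadj p ih =>
    obtain ⟨s, hs⟩ := ih hc
    obtain ⟨s', hs'⟩ := exists_cutCost_le_of_adj hL hadj s
    exact ⟨s', by rw [SimpleGraph.Walk.length_cons]; push_cast; linarith⟩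

theorem exists_cutCost_le_dropletDist (hL : 3 ≤ L) {x : Finset (Fin L)} (hx : x.Nonempty) :
    ∃ s, cutCost x s ≤ dropletDist x := by
  obtain ⟨c, hc, p, hp⟩ := exists_walk_length_eq_dropletDist hL hx
  rw [← hp]
  exact exists_cutCost_le_length hL (Finset.card_pos.2 hx) p hc

theorem dropletDist_pos (hL : 3 ≤ L) {x : Finset (Fin L)} (hx : x.Nonempty)
    (h : ¬ IsDroplet x) : 0 < dropletDist x := by
  obtain ⟨c, hc, p, hp⟩ := exists_walk_length_eq_dropletDist hL hx
  rcases Nat.eq_zero_or_pos (dropletDist x) with h0 | h0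
  · have := SimpleGraph.Walk.eq_of_length_eq_zero (hp.trans h0)
    rw [← this] at hc
    exact absurd hc h
  · exact h0

end Droplet

/-! ### Generating functions of hole counts -/

section Generating

/-- The weighted number of holes of `z ⊆ {0, …, m - 1}`, where a hole with `l` elements of `z` to
its left has the weight `w l`. -/
def holeWeight (w : ℕ → ℕ) (m : ℕ) (z : Finset ℕ) : ℕ :=
  ∑ j ∈ Finset.range m \ z, w (z.filter (· < j)).card

/-- The generating function of `holeWeight w m` over the `k`-element subsets of `{0, …, m - 1}`, at
the value `1 / 2`. -/
noncomputable def holeGen (w : ℕ → ℕ) (m k : ℕ) : ℝ :=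
  ∑ z ∈ (Finset.range m).powersetCard k, (1 / 2 : ℝ) ^ holeWeight w m z

theorem holeWeight_succ_of_subset (w : ℕ → ℕ) {m : ℕ} {z : Finset ℕ} (hz : z ⊆ Finset.range m) :
    holeWeight w (m + 1) z = w z.card + holeWeight w m z := by
  have hm : m ∉ z := fun h => by simpa using hz h
  rw [holeWeight, Finset.range_add_one, Finset.insert_sdiff_of_notMem _ hm,
    Finset.sum_insert (by simp), holeWeight, Finset.filter_true_of_mem]
  intro a ha
  simpa using hz ha

theorem holeWeight_succ_insert (w : ℕ → ℕ) {m : ℕ} {z : Finset ℕ} (hz : z ⊆ Finset.range m) :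
    holeWeight w (m + 1) (insert m z) = holeWeight w m z := by
  have hm : m ∉ z := fun h => by simpa using hz h
  have h1 : Finset.range (m + 1) \ insert m z = Finset.range m \ z := by
    ext a
    simp only [Finset.mem_sdiff, Finset.mem_range, Finset.mem_insert]
    grind
  rw [holeWeight, h1, holeWeight]
  refine Finset.sum_congr rfl fun j hj => ?_
  have hj : j < m := by simpa using (Finset.mem_sdiff.1 hj).1
  rw [Finset.filter_insert, if_neg (by omega)]

theorem holeGen_zero_zero (w : ℕ → ℕ) : holeGen w 0 0 = 1 := by
  simp [holeGen, holeWeight]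

theorem holeGen_zero_succ (w : ℕ → ℕ) (k : ℕ) : holeGen w 0 (k + 1) = 0 := by
  rw [holeGen, Finset.powersetCard_eq_empty.2 (by simp), Finset.sum_empty]

theorem holeGen_succ_zero (w : ℕ → ℕ) (m : ℕ) :
    holeGen w (m + 1) 0 = (1 / 2) ^ w 0 * holeGen w m 0 := by
  simp [holeGen, holeWeight]
  ring

/-- Distinguish whether the last position is a hole or not. -/
theorem holeGen_succ_succ (w : ℕ → ℕ) (m k : ℕ) :
    holeGen w (m + 1) (k + 1)
      = (1 / 2) ^ w (k + 1) * holeGen w m (k + 1) + holeGen w m k := by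
  have hsub : ∀ {j : ℕ} {z : Finset ℕ}, z ∈ (Finset.range m).powersetCard j →
      z ⊆ Finset.range m ∧ z.card = j := fun h => Finset.mem_powersetCard.1 h
  have hm : ∀ {j : ℕ} {z : Finset ℕ}, z ∈ (Finset.range m).powersetCard j → m ∉ z :=
    fun h h' => by simpa using (hsub h).1 h'
  rw [holeGen, Finset.range_add_one, Finset.powersetCard_succ_insert (by simp), Finset.sum_union]
  · congr 1
    · rw [holeGen, Finset.mul_sum]
      refine Finset.sum_congr rfl fun z hz => ?_
      rw [holeWeight_succ_of_subset w (hsub hz).1, (hsub hz).2, pow_add]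
    · rw [holeGen, Finset.sum_image]
      · exact Finset.sum_congr rfl fun z hz => by rw [holeWeight_succ_insert w (hsub hz).1]
      · intro a ha b hb hab
        have := congrArg (fun s => s.erase m) hab
        simpa [Finset.erase_insert (hm ha), Finset.erase_insert (hm hb)] using this
  · rw [Finset.disjoint_left]
    intro z hz hz'
    obtain ⟨a, -, rfl⟩ := Finset.mem_image.1 hz'
    exact hm hz (Finset.mem_insert_self m a)

/-- Distinguish whether the first position is a hole or not. -/
theorem holeGen_succ_succ_left (w : ℕ → ℕ) (m k : ℕ) :
    holeGen w (m + 1) (k + 1)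
      = (1 / 2) ^ w 0 * holeGen w m (k + 1) + holeGen (fun l => w (l + 1)) m k := by
  induction m generalizing k with
  | zero =>
    rw [holeGen_succ_succ]
    cases k <;> simp [holeGen_zero_zero, holeGen_zero_succ]
  | succ m ih =>
    conv_lhs => rw [holeGen_succ_succ, ih]
    cases k with
    | zero =>
      rw [holeGen_succ_succ w m 0, holeGen_succ_zero, holeGen_succ_zero]
      ring
    | succ k =>
      rw [ih k, holeGen_succ_succ w m (k + 1), holeGen_succ_succ _ m k]
      ring

theorem le_div_one_sub_pow {a S B : ℝ} {n : ℕ} (hn : 1 ≤ n) (hS : a ≤ (1 / 2) ^ n * S + B)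
    (hSB : S ≤ B / (1 - (1 / 2) ^ n)) : a ≤ B / (1 - (1 / 2) ^ n) := by
  have h1 : (1 / 2 : ℝ) ^ n ≤ 1 / 2 := pow_le_of_le_one (by norm_num) (by norm_num) (by omega)
  have h0 : (0 : ℝ) ≤ (1 / 2) ^ n := by positivity
  have hpos : (0 : ℝ) < 1 - (1 / 2) ^ n := by linarith
  calc a ≤ (1 / 2) ^ n * S + B := hS
    _ ≤ (1 / 2) ^ n * (B / (1 - (1 / 2) ^ n)) + B := by gcongr
    _ = B / (1 - (1 / 2) ^ n) := by field_simp; ring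

/-- The generating function of the partitions into at most `p` parts, at the value `1 / 2`, as an
Euler product. -/
noncomputable def eulerProd (p : ℕ) : ℝ := ∏ i ∈ Finset.range p, (1 - (1 / 2 : ℝ) ^ (i + 1))⁻¹

theorem eulerProd_succ (p : ℕ) : eulerProd (p + 1) = eulerProd p / (1 - (1 / 2) ^ (p + 1)) := by
  rw [eulerProd, Finset.prod_range_succ]
  exact (div_eq_mul_inv _ _).symm

theorem eulerProd_nonneg (p : ℕ) : 0 ≤ eulerProd p := by
  refine Finset.prod_nonneg fun i _ => inv_nonneg.2 (sub_nonneg.2 ?_)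
  exact pow_le_one₀ (by norm_num) (by norm_num)

theorem eulerProd_le_four (p : ℕ) : eulerProd p ≤ 4 := by
  -- The inverse products are at least `1 / 4 + (1 / 2) ^ (p + 1)` from `p = 1` on.
  have key : ∀ p : ℕ, eulerProd (p + 1) * (1 / 4 + (1 / 2) ^ (p + 2)) ≤ 1 := by
    intro p
    induction p with
    | zero => norm_num [eulerProd]
    | succ p ih =>
      rw [eulerProd_succ]
      have h0 : (0 : ℝ) < (1 / 2) ^ (p + 2) := by positivity
      have h1 : (1 / 2 : ℝ) ^ (p + 2) ≤ 1 / 4 := by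
        calc (1 / 2 : ℝ) ^ (p + 2) ≤ (1 / 2) ^ 2 :=
              pow_le_pow_of_le_one (by norm_num) (by norm_num) (by omega)
          _ = 1 / 4 := by norm_num
      have hpos : (0 : ℝ) < 1 - (1 / 2) ^ (p + 2) := by linarith
      rw [div_mul_eq_mul_div, div_le_one hpos, pow_succ _ (p + 2)]
      have h2 := eulerProd_nonneg (p + 1)
      set t : ℝ := (1 / 2) ^ (p + 2)
      have h3 : 1 / 4 + t * (1 / 2) ≤ (1 - t) * (1 / 4 + t) := by nlinarith
      calc eulerProd (p + 1) * (1 / 4 + t * (1 / 2))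
          ≤ eulerProd (p + 1) * ((1 - t) * (1 / 4 + t)) := by gcongr
        _ = (1 - t) * (eulerProd (p + 1) * (1 / 4 + t)) := by ring
        _ ≤ (1 - t) * 1 := by gcongr
        _ = 1 - t := mul_one _
  cases p with
  | zero => norm_num [eulerProd]
  | succ p =>
    have h := key p
    have h0 : (0 : ℝ) < (1 / 2) ^ (p + 2) := by positivity
    have := mul_nonneg (eulerProd_nonneg (p + 1)) h0.le
    nlinarith

theorem holeGen_congr {w w' : ℕ → ℕ} {k : ℕ} (h : ∀ l ≤ k, w l = w' l) (m : ℕ) :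
    holeGen w m k = holeGen w' m k := by
  refine Finset.sum_congr rfl fun z hz => ?_
  rw [holeWeight, holeWeight]
  congr 1
  refine Finset.sum_congr rfl fun j _ => h _ ?_
  exact (Finset.card_filter_le _ _).trans (Finset.mem_powersetCard.1 hz).2.le

/-- If the particles gather at the left end, then the configurations are counted by partitions. -/
theorem holeGen_id_le (m k : ℕ) : holeGen (fun l => l) m k ≤ eulerProd k := by
  induction k generalizing m with
  | zero =>
    induction m with
    | zero => simp [holeGen_zero_zero, eulerProd]
    | succ m ih => simpa [holeGen_succ_zero] using ih
  | succ k ihk =>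
    induction m with
    | zero => rw [holeGen_zero_succ]; exact eulerProd_nonneg _
    | succ m ihm =>
      rw [eulerProd_succ] at ihm ⊢
      rw [holeGen_succ_succ]
      exact le_div_one_sub_pow (by omega) (by gcongr; exact ihk m) ihm

/-- If `r` of the particles gather at the right end and `p` at the left end, then the configurations
are counted by pairs of partitions. -/
theorem holeGen_dist_le (m r p : ℕ) :
    holeGen (fun l => (l - r) + (r - l)) m (r + p) ≤ eulerProd r * eulerProd p := by
  induction r generalizing m with
  | zero =>
    simpa [eulerProd] using holeGen_id_le m p
  | succ r ihr =>
    rw [show r + 1 + p = (r + p) + 1 by omega]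
    induction m with
    | zero =>
      rw [holeGen_zero_succ]
      exact mul_nonneg (eulerProd_nonneg _) (eulerProd_nonneg _)
    | succ m ihm =>
      rw [eulerProd_succ, div_mul_eq_mul_div] at ihm ⊢
      rw [holeGen_succ_succ_left]
      refine le_div_one_sub_pow (by omega) ?_ ihm
      simp only [zero_tsub, tsub_zero, zero_add]
      gcongr
      refine le_trans (le_of_eq ?_) (ihr m)
      exact holeGen_congr (fun l _ => by omega) m

theorem holeGen_dist_le_sixteen (m : ℕ) {r k : ℕ} (hr : r ≤ k) :
    holeGen (fun l => (l - r) + (r - l)) m k ≤ 16 := by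
  obtain ⟨p, rfl⟩ := Nat.exists_eq_add_of_le hr
  have h1 := eulerProd_le_four r
  have h2 := eulerProd_le_four p
  have := eulerProd_nonneg r
  have := eulerProd_nonneg p
  refine (holeGen_dist_le m r p).trans ?_
  nlinarith

end Generating

/-- A bound on binomial coefficients off the centre: `C(m, k) ≤ 16 ^ k (17 / 16) ^ m`, together with
`17 ^ 8 ≤ 2 * 16 ^ 8`. -/
theorem choose_le_two_pow {m k D : ℕ} (h : m + 32 * k ≤ 8 * D) : m.choose k ≤ 2 ^ D := by
  rcases lt_or_ge m k with hmk | hkm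
  · simp [Nat.choose_eq_zero_of_lt hmk]
  have h1 : 16 ^ (m - k) * m.choose k ≤ 17 ^ m := by
    have h := Finset.single_le_sum (f := fun i => 1 ^ i * 16 ^ (m - i) * m.choose i)
      (fun i _ => Nat.zero_le _) (Finset.mem_range.2 (Nat.lt_succ_of_le hkm))
    have hp : ∑ i ∈ Finset.range (m + 1), 1 ^ i * 16 ^ (m - i) * m.choose i = 17 ^ m := by
      rw [show 17 = 1 + 16 from rfl, add_pow]
      simp
    rw [hp] at h
    simpa using h
  have h2 : 16 ^ m * m.choose k ≤ 16 ^ k * 17 ^ m := by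
    calc 16 ^ m * m.choose k = 16 ^ k * (16 ^ (m - k) * m.choose k) := by
          rw [← mul_assoc, ← pow_add, Nat.add_sub_cancel' hkm]
      _ ≤ 16 ^ k * 17 ^ m := by gcongr
  have e1 : ∀ a b : ℕ, (a ^ k * b ^ m) ^ 8 = (a ^ 8) ^ k * (b ^ 8) ^ m := fun a b => by ring
  have e2 : ∀ a b : ℕ, (a ^ 32) ^ k * (a * b ^ 8) ^ m = a ^ (m + 32 * k) * (b ^ m) ^ 8 :=
    fun a b => by ring
  have e3 : ∀ a b : ℕ, a ^ (8 * D) * (b ^ m) ^ 8 = (b ^ m * a ^ D) ^ 8 := fun a b => by ring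
  have h3 : (16 ^ m * m.choose k) ^ 8 ≤ (16 ^ m * 2 ^ D) ^ 8 := by
    calc (16 ^ m * m.choose k) ^ 8 ≤ (16 ^ k * 17 ^ m) ^ 8 := Nat.pow_le_pow_left h2 8
      _ = (16 ^ 8) ^ k * (17 ^ 8) ^ m := e1 16 17
      _ ≤ (2 ^ 32) ^ k * (2 * 16 ^ 8) ^ m :=
          Nat.mul_le_mul (Nat.pow_le_pow_left (by norm_num) k)
            (Nat.pow_le_pow_left (by norm_num) m)
      _ = 2 ^ (m + 32 * k) * (16 ^ m) ^ 8 := e2 2 16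
      _ ≤ 2 ^ (8 * D) * (16 ^ m) ^ 8 :=
          Nat.mul_le_mul_right _ (Nat.pow_le_pow_right (by norm_num) h)
      _ = (16 ^ m * 2 ^ D) ^ 8 := e3 2 16
  have h4 := (Nat.pow_le_pow_iff_left (by norm_num)).1 h3
  exact Nat.le_of_mul_le_mul_left h4 (by positivity)

/-! ### The sector -/

section Sector

variable {L : ℕ} [NeZero L]

theorem abs_sub_midSite_le_length (hL : 3 ≤ L) {v w : Fin L} (hw : w = midSite L)
    (p : (SimpleGraph.cycleGraph L).Walk v w) :
    |(v.val : ℤ) - (midSite L).val| ≤ p.length := by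
  induction p with
  | nil => simp [hw]
  | @cons u v w hadj p ih =>
    have ih := ih hw
    have h := (cycleGraph_adj_iff_val hL u v).1 hadj
    rw [SimpleGraph.Walk.length_cons]
    simp only [midSite, abs_le] at ih ⊢
    have := u.2
    have := v.2
    push_cast
    omega

theorem exists_walk_midSite (hL : 3 ≤ L) (d : ℕ) :
    ∀ v : Fin L, |(v.val : ℤ) - (midSite L).val| = d →
      ∃ p : (SimpleGraph.cycleGraph L).Walk v (midSite L), p.length = d := by
  induction d with
  | zero =>
    intro v hv
    have : v = midSite L := by
      apply Fin.ext
      have := abs_eq_zero.1 (hv.trans Nat.cast_zero)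
      omega
    subst this
    exact ⟨.nil, rfl⟩
  | succ d ih =>
    intro v hv
    have hv2 := v.2
    have hm := (midSite L).2
    obtain ⟨w, hw, hadj⟩ : ∃ w : Fin L, |(w.val : ℤ) - (midSite L).val| = d ∧
        (SimpleGraph.cycleGraph L).Adj v w := by
      rcases abs_eq (by positivity : (0 : ℤ) ≤ ((d + 1 : ℕ) : ℤ)) |>.1 hv with h | h
      · refine ⟨⟨v.val - 1, by omega⟩, ?_, (cycleGraph_adj_iff_val hL _ _).2 ?_⟩
        · rw [abs_of_nonneg (by simp only; omega)]
          simp only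
          omega
        · simp only
          omega
      · refine ⟨⟨v.val + 1, by omega⟩, ?_, (cycleGraph_adj_iff_val hL _ _).2 ?_⟩
        · rw [abs_of_nonpos (by simp only; omega)]
          simp only
          omega
        · exact Or.inl rfl
    obtain ⟨p, hp⟩ := ih w hw
    exact ⟨.cons hadj p, by simp [hp]⟩

/-- No site has a shorter way to the middle site through the edge that closes the ring. -/
theorem cycleGraph_dist_midSite (hL : 3 ≤ L) (v : Fin L) :
    ((SimpleGraph.cycleGraph L).dist v (midSite L) : ℤ) = |(v.val : ℤ) - (midSite L).val| := by
  obtain ⟨d, hd⟩ := Int.eq_ofNat_of_zero_le (abs_nonneg ((v.val : ℤ) - (midSite L).val))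
  obtain ⟨p, hp⟩ := exists_walk_midSite hL d v hd
  obtain ⟨p', hp'⟩ := p.reachable.exists_walk_length_eq_dist
  refine le_antisymm ?_ ?_
  · rw [hd]
    exact_mod_cast (SimpleGraph.dist_le p).trans hp.le
  · rw [← hp']
    exact abs_sub_midSite_le_length hL rfl p'

theorem exists_sector_eq_interval (hL : 3 ≤ L) {θ : ℝ} (hθ : 0 < θ) (hθ' : θ < 1 / 16) :
    ∃ a b : ℕ, 0 < a ∧ a ≤ b ∧ b + 1 < L ∧ (sectorMin L θ).val = a ∧ (sectorMax L θ).val = b ∧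
      (∀ v, v ∈ sector L θ ↔ a ≤ v.val ∧ v.val ≤ b) ∧
      2 * (θ * L) ≤ (b : ℝ) + 2 - a ∧ (b : ℝ) < a + 2 * (θ * L) := by
  have hLr : (3 : ℝ) ≤ L := by exact_mod_cast hL
  have hpos : 0 < θ * L := by positivity
  obtain ⟨R, hR1, hR2⟩ : ∃ R : ℕ, (R : ℝ) < θ * L ∧ θ * L ≤ R + 1 := by
    refine ⟨⌈θ * L⌉₊ - 1, ?_, ?_⟩
    · exact Nat.lt_ceil.1 (Nat.sub_lt (Nat.ceil_pos.2 hpos) one_pos)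
    · have h1 := Nat.le_ceil (θ * L)
      have h2 : ((⌈θ * L⌉₊ - 1 : ℕ) : ℝ) + 1 = ⌈θ * L⌉₊ := by
        have : ⌈θ * L⌉₊ - 1 + 1 = ⌈θ * L⌉₊ := Nat.sub_add_cancel (Nat.ceil_pos.2 hpos)
        exact_mod_cast this
      linarith
  have hR3 : 16 * R < L := by
    have : (16 : ℝ) * R < L := by nlinarith
    exact_mod_cast this
  have hmem : ∀ v : Fin L, v ∈ sector L θ ↔
      (L - 1) / 2 - R ≤ v.val ∧ v.val ≤ (L - 1) / 2 + R := by
    intro v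
    have hd := cycleGraph_dist_midSite hL v
    have h1 : v ∈ sector L θ ↔ (SimpleGraph.cycleGraph L).dist v (midSite L) ≤ R := by
      simp only [sector, Finset.mem_filter, Finset.mem_univ, true_and]
      constructor
      · intro h
        have : ((SimpleGraph.cycleGraph L).dist v (midSite L) : ℝ) < R + 1 := by linarith
        exact Nat.lt_succ_iff.1 (by exact_mod_cast this)
      · intro h
        have : ((SimpleGraph.cycleGraph L).dist v (midSite L) : ℝ) ≤ R := by exact_mod_cast h
        linarith
    rw [h1, ← Int.ofNat_le, hd, abs_le]
    simp only [midSite]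
    omega
  refine ⟨(L - 1) / 2 - R, (L - 1) / 2 + R, by omega, by omega, by omega, ?_, ?_, hmem, ?_, ?_⟩
  · have h : IsLeast (sector L θ : Set (Fin L)) ⟨(L - 1) / 2 - R, by omega⟩ :=
      ⟨(hmem _).2 (by simp only; omega), fun w hw => Fin.le_def.2 ((hmem w).1 hw).1⟩
    rw [(isLeast_sectorMin L hθ).unique h]
  · have h : IsGreatest (sector L θ : Set (Fin L)) ⟨(L - 1) / 2 + R, by omega⟩ :=
      ⟨(hmem _).2 (by simp only; omega), fun w hw => Fin.le_def.2 ((hmem w).1 hw).2⟩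
    rw [(isGreatest_sectorMax L hθ).unique h]
  · rw [Nat.cast_sub (by omega)]
    push_cast
    linarith
  · rw [Nat.cast_sub (by omega)]
    push_cast
    linarith

theorem val_site {j : ℤ} (h0 : 0 ≤ j) (h1 : j < L) : ((site L j).val : ℤ) = j := by
  have := (site_eq_iff j (site L j)).1 rfl
  rw [← this, Int.emod_eq_of_lt h0 h1]

theorem mem_leftCluster_iff {θ : ℝ} {a n : ℕ} (ha : (sectorMin L θ).val = a) (h : a + n ≤ L)
    (v : Fin L) : v ∈ leftCluster L θ n ↔ a ≤ v.val ∧ v.val < a + n := by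
  simp only [leftCluster, Finset.mem_image, Finset.mem_range, site_eq_iff, ha]
  constructor
  · rintro ⟨j, hj, h⟩
    rw [Int.emod_eq_of_lt (by omega) (by omega)] at h
    omega
  · rintro ⟨h1, h2⟩
    exact ⟨v.val - a, by omega, by rw [Int.emod_eq_of_lt (by omega) (by omega)]; omega⟩

theorem mem_rightCluster_iff {θ : ℝ} {b n : ℕ} (hb : (sectorMax L θ).val = b) (h : n ≤ b + 1)
    (v : Fin L) : v ∈ rightCluster L θ n ↔ b < v.val + n ∧ v.val ≤ b := by
  have hbL : b < L := hb ▸ (sectorMax L θ).2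
  simp only [rightCluster, Finset.mem_image, Finset.mem_range, site_eq_iff, hb]
  constructor
  · rintro ⟨j, hj, h⟩
    rw [Int.emod_eq_of_lt (by omega) (by omega)] at h
    omega
  · rintro ⟨h1, h2⟩
    exact ⟨b - v.val, by omega, by rw [Int.emod_eq_of_lt (by omega) (by omega)]; omega⟩

end Sector

/-! ### Holes inside and outside of an interval -/

section Decomposition

/-- The position of the site `v` when the sites of the ring are read cyclically from the site after
`b` on. -/
def indexAfter {L : ℕ} (b : ℕ) (v : Fin L) : ℕ :=
  if b < v.val then v.val - (b + 1) else v.val + L - (b + 1)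

theorem indexAfter_injective {L b : ℕ} (hb : b < L) :
    Function.Injective (indexAfter b : Fin L → ℕ) := by
  intro u v h
  have := u.2
  have := v.2
  apply Fin.ext
  simp only [indexAfter] at h
  split_ifs at h <;> omega

variable {L : ℕ} {a b : ℕ} {Λ y z : Finset (Fin L)}

theorem card_interval (hab : a ≤ b) (hb : b + 1 < L)
    (hΛ : ∀ v, v ∈ Λ ↔ a ≤ v.val ∧ v.val ≤ b) : Λ.card = b + 1 - a := by
  have : Λ = Finset.Icc ⟨a, by omega⟩ ⟨b, by omega⟩ := by
    ext v
    rw [hΛ, Finset.mem_Icc, Fin.le_def, Fin.le_def]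
  rw [this, Fin.card_Icc]

theorem image_indexAfter_compl (hab : a ≤ b) (hb : b + 1 < L)
    (hΛ : ∀ v, v ∈ Λ ↔ a ≤ v.val ∧ v.val ≤ b) :
    Λᶜ.image (indexAfter b) = Finset.range (L - (b + 1 - a)) := by
  refine Finset.eq_of_subset_of_card_le (fun j hj => ?_) ?_
  · obtain ⟨v, hv, rfl⟩ := Finset.mem_image.1 hj
    rw [Finset.mem_compl, hΛ] at hv
    have := v.2
    rw [Finset.mem_range, indexAfter]
    split_ifs <;> omega
  · rw [Finset.card_image_of_injective _ (indexAfter_injective (by omega)), Finset.card_compl,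
      card_interval hab hb hΛ]
    simp

theorem before_union (hyz : Disjoint y z) (v : Fin L) :
    before (y ∪ z) v = before y v + before z v := by
  rw [before, Finset.filter_union, Finset.card_union_of_disjoint]
  · rfl
  · exact Finset.disjoint_filter_filter hyz

/-- The cost of a configuration splits into the contributions of the holes inside an interval and of
the holes outside of it. The outer sites are read cyclically from the right end of the interval to
its left end. -/
theorem cutCost_union (hab : a ≤ b) (hb : b + 1 < L)
    (hΛ : ∀ v, v ∈ Λ ↔ a ≤ v.val ∧ v.val ≤ b) (hy : y ⊆ Λ) (hz : z ⊆ Λᶜ) (s : ℤ) :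
    cutCost (y ∪ z) s
      = ∑ v ∈ Λ \ y, circDist (y.card + z.card)
          (before y v + (z.filter fun u => u.val < a).card - s)
        + ∑ j ∈ Finset.range (L - (b + 1 - a)) \ z.image (indexAfter b),
            circDist (y.card + z.card) (y.card + ((z.image (indexAfter b)).filter (· < j)).card
              + (z.filter fun u => u.val < a).card - s) := by
  have hinj : Function.Injective (indexAfter b : Fin L → ℕ) := indexAfter_injective (by omega)
  have hz' : ∀ u ∈ z, u.val < a ∨ b < u.val := fun u hu => by
    have := mt (hΛ u).2 (Finset.mem_compl.1 (hz hu))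
    omega
  have hy' : ∀ u ∈ y, a ≤ u.val ∧ u.val ≤ b := fun u hu => (hΛ u).1 (hy hu)
  have hyz : Disjoint y z := Finset.disjoint_left.2 fun u hu hu' =>
    Finset.mem_compl.1 (hz hu') (hy hu)
  have hcompl : (y ∪ z)ᶜ = (Λ \ y) ∪ (Λᶜ \ z) := by
    ext v
    have h1 := @hy v
    have h2 := @hz v
    simp only [Finset.mem_compl, Finset.mem_union, Finset.mem_sdiff] at *
    tauto
  have hdisj : Disjoint (Λ \ y) (Λᶜ \ z) :=
    Finset.disjoint_of_subset_left Finset.sdiff_subset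
      (Finset.disjoint_of_subset_right Finset.sdiff_subset disjoint_compl_right)
  rw [cutCost, hcompl, Finset.sum_union hdisj, Finset.card_union_of_disjoint hyz,
    ← image_indexAfter_compl hab hb hΛ, ← Finset.image_sdiff _ _ hinj,
    Finset.sum_image hinj.injOn]
  push_cast
  congr 1
  · refine Finset.sum_congr rfl fun v hv => ?_
    have hv := (hΛ v).1 (Finset.mem_sdiff.1 hv).1
    have : before z v = (z.filter fun u => u.val < a).card := by
      rw [before]
      congr 1
      refine Finset.filter_congr fun u hu => ?_
      have := hz' u hu
      rw [Fin.lt_def]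
      omega
    rw [before_union hyz, this]
    push_cast
    rfl
  · refine Finset.sum_congr rfl fun v hv => ?_
    have hv := mt (hΛ v).2 (Finset.mem_compl.1 (Finset.mem_sdiff.1 hv).1)
    have hvL := v.2
    have himg : ((z.image (indexAfter b)).filter (· < indexAfter b v)).card
        = (z.filter fun u => indexAfter b u < indexAfter b v).card := by
      rw [Finset.filter_image, Finset.card_image_of_injective _ hinj]
    rw [himg, before_union hyz]
    by_cases hvb : b < v.val
    · have h1 : before y v = y.card := by
        rw [before, Finset.filter_true_of_mem]
        intro u hu
        have := hy' u hu
        rw [Fin.lt_def]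
        omega
      have h2 : before z v = (z.filter fun u => indexAfter b u < indexAfter b v).card
          + (z.filter fun u => u.val < a).card := by
        rw [before, Finset.card_filter, Finset.card_filter, Finset.card_filter,
          ← Finset.sum_add_distrib]
        refine Finset.sum_congr rfl fun u hu => ?_
        have := hz' u hu
        have := u.2
        simp only [Fin.lt_def, indexAfter]
        split_ifs <;> omega
      rw [h1, h2]
      push_cast
      congr 1
      ring
    · -- The sites left of the interval come last in the cyclic order, after all the particles to
      -- the right of the interval: the count differs by a full turn.
      have h1 : before y v = 0 := by
        rw [before, Finset.card_eq_zero, Finset.filter_eq_empty_iff]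
        intro u hu
        have := hy' u hu
        rw [Fin.lt_def]
        omega
      have h2 : z.card + before z v = (z.filter fun u => indexAfter b u < indexAfter b v).card
          + (z.filter fun u => u.val < a).card := by
        rw [before, Finset.card_filter, Finset.card_filter, Finset.card_filter,
          Finset.card_eq_sum_ones, ← Finset.sum_add_distrib, ← Finset.sum_add_distrib]
        refine Finset.sum_congr rfl fun u hu => ?_
        have := hz' u hu
        have := u.2
        simp only [Fin.lt_def, indexAfter]
        split_ifs <;> omega
      have h3 : (y.card : ℤ) + (z.filter fun u => indexAfter b u < indexAfter b v).card
          + (z.filter fun u => u.val < a).card - s = (before z v - s) + (y.card + z.card) := by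
        have : ((z.card + before z v : ℕ) : ℤ) = _ := congrArg Nat.cast h2
        push_cast at this
        linarith
      rw [h3, circDist_add_self, h1]
      push_cast
      congr 1
      ring

theorem circDist_add_mul_self (N t q : ℤ) : circDist N (t + N * q) = circDist N t := by
  simp [circDist]

theorem exists_sum_circDist_le_dropletDist [NeZero L] (hL : 3 ≤ L) (hab : a ≤ b) (hb : b + 1 < L)
    (hΛ : ∀ v, v ∈ Λ ↔ a ≤ v.val ∧ v.val ≤ b) (hy : y ⊆ Λ) (hz : z ⊆ Λᶜ)
    (hN : 0 < y.card + z.card) :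
    ∃ σ : ℤ, 1 ≤ σ ∧ σ ≤ y.card + z.card ∧
      ∑ v ∈ Λ \ y, circDist (y.card + z.card) (before y v - σ)
        + ∑ j ∈ Finset.range (L - (b + 1 - a)) \ z.image (indexAfter b),
            circDist (y.card + z.card)
              (y.card + ((z.image (indexAfter b)).filter (· < j)).card - σ)
        ≤ dropletDist (y ∪ z) := by
  have hne : (y ∪ z).Nonempty := by
    rw [Finset.union_nonempty, ← Finset.card_pos, ← Finset.card_pos]
    omega
  obtain ⟨s, hs⟩ := exists_cutCost_le_dropletDist hL hne
  rw [cutCost_union hab hb hΛ hy hz] at hs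
  set A : ℤ := ((z.filter fun u => u.val < a).card : ℤ)
  set N : ℤ := (y.card : ℤ) + z.card
  have hN' : 0 < N := by simp only [N]; omega
  have h0 := Int.emod_nonneg (s - A - 1) hN'.ne'
  have h1 := Int.emod_lt_of_pos (s - A - 1) hN'
  refine ⟨(s - A - 1) % N + 1, by omega, by omega, ?_⟩
  have key : ∀ t : ℤ, circDist N (t - ((s - A - 1) % N + 1)) = circDist N (t + A - s) := by
    intro t
    rw [← circDist_add_mul_self N (t + A - s) ((s - A - 1) / N)]
    congr 1
    have := Int.emod_add_mul_ediv (s - A - 1) N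
    linarith
  simpa only [key] using hs

/-- Adding the site to the right of the interval gives a configuration that can be gathered within
the interval and that site. -/
theorem dropletDist_union_right_le [NeZero L] (hL : 3 ≤ L) (hab : a ≤ b) (hb : b + 1 < L)
    (hΛ : ∀ v, v ∈ Λ ↔ a ≤ v.val ∧ v.val ≤ b) (hy : y ⊆ Λ) {w : Fin L} (hw : w.val = b + 1) :
    (dropletDist (y ∪ {w}) : ℤ)
      ≤ ∑ v ∈ Λ \ y, min (before y v : ℤ) (y.card + 1 - before y v) := by
  refine (dropletDist_le_cutCost_zero hL ⟨w, by simp⟩).trans ?_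
  have hz : {w} ⊆ Λᶜ := by
    rw [Finset.singleton_subset_iff, Finset.mem_compl, hΛ]
    omega
  have hA : (({w} : Finset (Fin L)).filter fun u => u.val < a).card = 0 := by
    rw [Finset.card_eq_zero, Finset.filter_eq_empty_iff]
    simp only [Finset.mem_singleton, forall_eq]
    omega
  have hi : indexAfter b w = 0 := by
    rw [indexAfter, if_pos (by omega)]
    omega
  rw [cutCost_union hab hb hΛ hy hz, hA, Finset.card_singleton, Finset.image_singleton, hi]
  rw [Finset.sum_eq_zero (s := Finset.range _ \ _), add_zero]
  · refine Finset.sum_le_sum fun v _ => le_of_eq ?_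
    have := before_le_card y v
    push_cast
    rw [add_zero, sub_zero, circDist_of_nonneg_of_le (by omega) (by omega)]
  · intro j hj
    have hj : 0 < j := by
      simp only [Finset.mem_sdiff, Finset.mem_singleton] at hj
      omega
    rw [Finset.filter_true_of_mem (by simpa using hj), Finset.card_singleton,
      circDist_of_nonneg_of_le (by push_cast; omega) (by push_cast; omega)]
    push_cast
    omega

/-- The mirror image of `dropletDist_union_right_le`. -/
theorem dropletDist_union_left_le [NeZero L] (hL : 3 ≤ L) (hab : a ≤ b) (hb : b + 1 < L)
    (hΛ : ∀ v, v ∈ Λ ↔ a ≤ v.val ∧ v.val ≤ b) (hy : y ⊆ Λ) {w : Fin L} (hw : w.val + 1 = a) :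
    (dropletDist (y ∪ {w}) : ℤ)
      ≤ ∑ v ∈ Λ \ y, min (before y v + 1 : ℤ) (y.card - before y v) := by
  refine (dropletDist_le_cutCost_zero hL ⟨w, by simp⟩).trans ?_
  have hz : {w} ⊆ Λᶜ := by
    rw [Finset.singleton_subset_iff, Finset.mem_compl, hΛ]
    omega
  have hA : (({w} : Finset (Fin L)).filter fun u => u.val < a).card = 1 := by
    rw [Finset.filter_true_of_mem, Finset.card_singleton]
    simp only [Finset.mem_singleton, forall_eq]
    omega
  have hi : indexAfter b w + 1 = L - (b + 1 - a) := by
    rw [indexAfter, if_neg (by omega)]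
    omega
  rw [cutCost_union hab hb hΛ hy hz, hA, Finset.card_singleton, Finset.image_singleton]
  rw [Finset.sum_eq_zero (s := Finset.range _ \ _), add_zero]
  · refine Finset.sum_le_sum fun v _ => le_of_eq ?_
    have := before_le_card y v
    push_cast
    rw [sub_zero, circDist_of_nonneg_of_le (by omega) (by omega)]
    omega
  · intro j hj
    have hj : j < indexAfter b w := by
      simp only [Finset.mem_sdiff, Finset.mem_singleton, Finset.mem_range] at hj
      omega
    have hf : ({indexAfter b w} : Finset ℕ).filter (· < j) = ∅ := by
      rw [Finset.filter_eq_empty_iff]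
      simp only [Finset.mem_singleton, forall_eq]
      omega
    rw [hf, Finset.card_empty,
      circDist_of_nonneg_of_le (by push_cast; omega) (by push_cast; omega)]
    push_cast
    omega

end Decomposition

section Comparison

variable {α β : Type*} {P : Finset α} {Q : Finset β} {ℓ : α → ℕ} {l : β → ℕ} {n k T d : ℕ}

/-- The ring is cut open between two outer particles, `r` of which gather at the right end of the
interval. The cost inside of the interval exceeds that of one outer particle by the number of holes
in the interval, unless the outer particles gather on one side only or are at most two. -/
theorem le_of_cut_outside (hk : 1 ≤ k) (hkn : k < n) (hℓ : ∀ v ∈ P, ℓ v ≤ n)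
    (hl : ∀ j ∈ Q, l j ≤ k)
    (hT : ((T : ℤ) ≤ ∑ v ∈ P, min (ℓ v : ℤ) (n + 1 - ℓ v) ∧
        (T : ℤ) ≤ ∑ v ∈ P, min (ℓ v + 1 : ℤ) (n - ℓ v)) ∨
      (T = 1 ∧ ((∀ v ∈ P, ℓ v = 0) ∨ ∀ v ∈ P, ℓ v = n)))
    {r : ℕ} (hr : r ≤ k) (hd1 : 1 ≤ d)
    (hd : ∑ v ∈ P, circDist (n + k) (ℓ v - (n + r)) + ∑ j ∈ Q, circDist (n + k) (n + l j - (n + r))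
      ≤ d) :
    T ≤ d ∧ T + ∑ j ∈ Q, ((l j - r) + (r - l j)) + (if 1 ≤ r ∧ r < k ∧ 3 ≤ k then P.card else 0)
      ≤ d + 1 := by
  have h1 : ∑ v ∈ P, circDist (n + k) (ℓ v - (n + r))
      = ∑ v ∈ P, min (n + r - ℓ v : ℤ) (k - r + ℓ v) := by
    refine Finset.sum_congr rfl fun v hv => ?_
    have := hℓ v hv
    rw [circDist_of_nonpos_of_le (by omega) (by omega)]
    omega
  have h2 : ∑ j ∈ Q, circDist (n + k) (n + l j - (n + r))
      = ((∑ j ∈ Q, ((l j - r) + (r - l j)) : ℕ) : ℤ) := by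
    rw [Nat.cast_sum]
    refine Finset.sum_congr rfl fun j hj => ?_
    have := hl j hj
    rcases le_total r (l j) with h | h
    · rw [circDist_of_nonneg_of_le (by omega) (by omega)]
      omega
    · rw [circDist_of_nonpos_of_le (by omega) (by omega)]
      omega
  rw [h1, h2] at hd
  have hc : ((P.card : ℕ) : ℤ) = ∑ v ∈ P, 1 := by simp
  -- It suffices to bound the cost inside of the interval.
  suffices h : ((T : ℤ) ≤ ∑ v ∈ P, min (n + r - ℓ v : ℤ) (k - r + ℓ v) ∨ T = 1) ∧
      (T : ℤ) + (if 1 ≤ r ∧ r < k ∧ 3 ≤ k then P.card else 0)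
        ≤ ∑ v ∈ P, min (n + r - ℓ v : ℤ) (k - r + ℓ v) + 1 by
    obtain ⟨h3, h4⟩ := h
    generalize (∑ j ∈ Q, ((l j - r) + (r - l j))) = E at hd ⊢
    generalize (if 1 ≤ r ∧ r < k ∧ 3 ≤ k then P.card else 0) = F at h4 ⊢
    omega
  rcases hT with ⟨hTr, hTl⟩ | ⟨hT1, hy⟩
  · have e1 : r = k → (T : ℤ) ≤ ∑ v ∈ P, min (n + r - ℓ v : ℤ) (k - r + ℓ v) := fun h =>
      hTr.trans (Finset.sum_le_sum fun v _ => by omega)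
    have e2 : r < k → (T : ℤ) ≤ ∑ v ∈ P, min (n + r - ℓ v : ℤ) (k - r + ℓ v) := fun h =>
      hTl.trans (Finset.sum_le_sum fun v _ => by omega)
    have e3 : (T : ℤ) ≤ ∑ v ∈ P, min (n + r - ℓ v : ℤ) (k - r + ℓ v) :=
      hr.lt_or_eq.elim e2 e1
    refine ⟨Or.inl e3, ?_⟩
    split_ifs with h
    · have e4 : (T : ℤ) + P.card ≤ ∑ v ∈ P, min (n + r - ℓ v : ℤ) (k - r + ℓ v) := by
        rcases lt_or_ge r 2 with h' | h'
        · refine (add_le_add_left hTl _).trans ?_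
          rw [hc, ← Finset.sum_add_distrib]
          exact Finset.sum_le_sum fun v _ => by omega
        · refine (add_le_add_left hTr _).trans ?_
          rw [hc, ← Finset.sum_add_distrib]
          exact Finset.sum_le_sum fun v _ => by omega
      linarith
    · push_cast
      linarith
  · refine ⟨Or.inr hT1, ?_⟩
    rw [hT1]
    split_ifs with h
    · have : ((P.card : ℕ) : ℤ) ≤ ∑ v ∈ P, min (n + r - ℓ v : ℤ) (k - r + ℓ v) := by
        rw [hc]
        refine Finset.sum_le_sum fun v hv => ?_
        rcases hy with hy | hy <;> have := hy v hv <;> omega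
      push_cast
      linarith
    · have : (0 : ℤ) ≤ ∑ v ∈ P, min (n + r - ℓ v : ℤ) (k - r + ℓ v) :=
        Finset.sum_nonneg fun v hv => by have := hℓ v hv; omega
      push_cast
      linarith

/-- The ring is cut open between two particles of the interval: then every outer hole is crossed. -/
theorem le_of_cut_inside (hkn : k < n) (hℓ : ∀ v ∈ P, ℓ v ≤ n) (hl : ∀ j ∈ Q, l j ≤ k)
    (hT : ((T : ℤ) ≤ ∑ v ∈ P, min (ℓ v : ℤ) (n + 1 - ℓ v) ∧
        (T : ℤ) ≤ ∑ v ∈ P, min (ℓ v + 1 : ℤ) (n - ℓ v)) ∨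
      (T = 1 ∧ ((∀ v ∈ P, ℓ v = 0) ∨ ∀ v ∈ P, ℓ v = n)))
    (hP : 1 ≤ P.card) (hPQ : 2 * P.card ≤ Q.card) {i : ℕ} (hi : 1 ≤ i) (hin : i < n)
    (hd : ∑ v ∈ P, circDist (n + k) (ℓ v - i) + ∑ j ∈ Q, circDist (n + k) (n + l j - i) ≤ d) :
    T + Q.card ≤ d + 2 * P.card := by
  have hN : (0 : ℤ) < n + k := by omega
  obtain ⟨g, hg1, hgi, hgn, hg⟩ : ∃ g : ℕ, 1 ≤ g ∧ g ≤ i ∧ g ≤ n - i ∧ (g = i ∨ g = n - i) :=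
    ⟨min i (n - i), by omega, by omega, by omega, by omega⟩
  have h1 : (g : ℤ) * Q.card ≤ ∑ j ∈ Q, circDist (n + k) (n + l j - i) := by
    rw [mul_comm, ← nsmul_eq_mul]
    refine Finset.card_nsmul_le_sum _ _ _ fun j hj => ?_
    have := hl j hj
    rw [circDist_of_nonneg_of_le (by omega) (by omega)]
    omega
  have hcirc : ∀ v ∈ P, circDist (n + k) (ℓ v - i)
      = min (|(ℓ v : ℤ) - i|) (n + k - |(ℓ v : ℤ) - i|) := by
    intro v hv
    have := hℓ v hv
    rcases le_total (i : ℤ) (ℓ v) with h | h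
    · rw [circDist_of_nonneg_of_le (by omega) (by omega), abs_of_nonneg (by omega)]
    · rw [circDist_of_nonpos_of_le (by omega) (by omega), abs_of_nonpos (by omega)]
      omega
  have h2 : (T : ℤ) ≤ ∑ v ∈ P, circDist (n + k) (ℓ v - i) + (g + 1) * P.card ∨ T = 1 := by
    rcases hT with ⟨hTr, hTl⟩ | ⟨hT1, -⟩
    · left
      have hc : ((g : ℤ) + 1) * P.card = ∑ v ∈ P, ((g : ℤ) + 1) := by
        rw [Finset.sum_const, nsmul_eq_mul, mul_comm]
      rw [hc, ← Finset.sum_add_distrib]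
      rcases hg with hg | hg
      · refine hTl.trans (Finset.sum_le_sum fun v hv => ?_)
        have := hℓ v hv
        rw [hcirc v hv]
        rcases abs_cases ((ℓ v : ℤ) - i) with h | h <;> omega
      · refine hTr.trans (Finset.sum_le_sum fun v hv => ?_)
        have := hℓ v hv
        rw [hcirc v hv]
        rcases abs_cases ((ℓ v : ℤ) - i) with h | h <;> omega
    · exact Or.inr hT1
  zify
  have h3 : (0 : ℤ) ≤ (g - 1) * (Q.card - P.card) :=
    mul_nonneg (by omega) (by omega)
  have h4 : (0 : ℤ) ≤ ∑ v ∈ P, circDist (n + k) (ℓ v - i) :=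
    Finset.sum_nonneg fun _ _ => circDist_nonneg hN _
  rcases h2 with h2 | h2
  · nlinarith
  · rw [h2]
    have h5 : (0 : ℤ) ≤ (g - 1) * Q.card := mul_nonneg (by omega) (by omega)
    have : (1 : ℤ) ≤ P.card := by exact_mod_cast hP
    push_cast
    nlinarith

end Comparison

/-! ### Summation over the outer particles -/

section Summation

theorem exp_neg_mul_natCast_eq_pow (μ : ℝ) (d : ℕ) :
    Real.exp (-μ * d) = Real.exp (-μ) ^ d := by
  rw [← Real.exp_nat_mul, mul_comm]

theorem exp_neg_le_half {μ : ℝ} (hμ : Real.log 2 ≤ μ) : Real.exp (-μ) ≤ 1 / 2 := by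
  calc Real.exp (-μ) ≤ Real.exp (-Real.log 2) := Real.exp_le_exp.2 (by linarith)
    _ = 1 / 2 := by rw [Real.exp_neg, Real.exp_log (by norm_num)]; norm_num

/-- Once the exponent `T` has been split off, the value `1 / 2` is the worst case. -/
theorem pow_le_pow_mul_of_half {q g : ℝ} (hq0 : 0 ≤ q) (hq : q ≤ 1 / 2) {T d : ℕ} (hTd : T ≤ d)
    (h : (1 / 2 : ℝ) ^ d ≤ (1 / 2) ^ T * g) : q ^ d ≤ q ^ T * g := by
  obtain ⟨e, rfl⟩ := Nat.exists_eq_add_of_le hTd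
  rw [pow_add] at h ⊢
  have h1 : (1 / 2 : ℝ) ^ e ≤ g := le_of_mul_le_mul_left h (by positivity)
  have h2 : q ^ e ≤ (1 / 2) ^ e := pow_le_pow_left₀ hq0 hq e
  exact mul_le_mul_of_nonneg_left (h2.trans h1) (by positivity)

theorem sum_half_pow_ite_le {k H : ℕ} (hH : k + 1 ≤ 2 ^ H) :
    ∑ r ∈ Finset.range (k + 1), (1 / 2 : ℝ) ^ (if 1 ≤ r ∧ r < k ∧ 3 ≤ k then H else 0) ≤ 4 := by
  have h1 : ∀ r ∈ Finset.range (k + 1),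
      (1 / 2 : ℝ) ^ (if 1 ≤ r ∧ r < k ∧ 3 ≤ k then H else 0)
        ≤ (((if r = 0 then 1 else 0) + (if r = 1 then 1 else 0)) + (if r = k then 1 else 0))
          + (1 / 2) ^ H := by
    intro r hr
    rw [Finset.mem_range] at hr
    have h0 : (0 : ℝ) < (1 / 2) ^ H := by positivity
    by_cases h : 1 ≤ r ∧ r < k ∧ 3 ≤ k
    · rw [if_pos h]
      have : (0 : ℝ) ≤ ((if r = 0 then 1 else 0) + (if r = 1 then 1 else 0))
          + (if r = k then 1 else 0) := by positivity
      linarith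
    · rw [if_neg h, pow_zero]
      have : r = 0 ∨ r = 1 ∨ r = k := by omega
      split_ifs <;> first | linarith | omega
  have h2 : ((k : ℝ) + 1) * (1 / 2) ^ H ≤ 1 := by
    have : ((k : ℝ) + 1) ≤ 2 ^ H := by exact_mod_cast hH
    rw [one_div, inv_pow, ← div_eq_mul_inv]
    exact div_le_one_of_le₀ this (by positivity)
  have h3 : ∀ s : ℕ, ∑ r ∈ Finset.range (k + 1), (if r = s then (1 : ℝ) else 0) ≤ 1 := by
    intro s
    rw [Finset.sum_ite_eq']
    split_ifs <;> norm_num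
  refine (Finset.sum_le_sum h1).trans ?_
  rw [Finset.sum_add_distrib, Finset.sum_add_distrib, Finset.sum_add_distrib, Finset.sum_const,
    Finset.card_range, nsmul_eq_mul]
  push_cast
  linarith [h3 0, h3 1, h3 k]

/-- The bound on the weight `(1 / 2) ^ (d - T)` of a configuration whose outer particles have the
positions `w ⊆ {0, …, m - 1}`: a sum over the possible cuts between outer particles, and a term for
the cuts between inner particles. -/
noncomputable def cutBound (m k H : ℕ) (w : Finset ℕ) : ℝ :=
  ∑ r ∈ Finset.range (k + 1), 2 * (1 / 2 : ℝ) ^ (if 1 ≤ r ∧ r < k ∧ 3 ≤ k then H else 0)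
      * (1 / 2) ^ holeWeight (fun l => (l - r) + (r - l)) m w
    + (1 / 2) ^ (m - k - 2 * H)

theorem cutBound_nonneg (m k H : ℕ) (w : Finset ℕ) : 0 ≤ cutBound m k H w := by
  rw [cutBound]
  positivity

theorem sum_cutBound_le {m k H : ℕ} (hH : k + 1 ≤ 2 ^ H)
    (hD : m + 32 * k ≤ 8 * (m - k - 2 * H)) :
    ∑ w ∈ (Finset.range m).powersetCard k, cutBound m k H w ≤ 129 := by
  simp only [cutBound]
  rw [Finset.sum_add_distrib, Finset.sum_comm, Finset.sum_const, Finset.card_powersetCard,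
    Finset.card_range, nsmul_eq_mul]
  have h1 : ((m.choose k : ℕ) : ℝ) * (1 / 2) ^ (m - k - 2 * H) ≤ 1 := by
    have : ((m.choose k : ℕ) : ℝ) ≤ 2 ^ (m - k - 2 * H) := by exact_mod_cast choose_le_two_pow hD
    rw [one_div, inv_pow, ← div_eq_mul_inv]
    exact div_le_one_of_le₀ this (by positivity)
  have h2 : ∀ r ∈ Finset.range (k + 1), ∑ w ∈ (Finset.range m).powersetCard k,
      2 * (1 / 2 : ℝ) ^ (if 1 ≤ r ∧ r < k ∧ 3 ≤ k then H else 0)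
        * (1 / 2) ^ holeWeight (fun l => (l - r) + (r - l)) m w
      ≤ 32 * (1 / 2) ^ (if 1 ≤ r ∧ r < k ∧ 3 ≤ k then H else 0) := by
    intro r hr
    have h := holeGen_dist_le_sixteen m (Nat.lt_succ_iff.1 (Finset.mem_range.1 hr))
    rw [holeGen] at h
    rw [← Finset.mul_sum]
    have h0 : (0 : ℝ) ≤ 2 * (1 / 2) ^ (if 1 ≤ r ∧ r < k ∧ 3 ≤ k then H else 0) := by positivity
    have := mul_le_mul_of_nonneg_left h h0
    linarith
  have h3 := Finset.sum_le_sum h2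
  rw [← Finset.mul_sum] at h3
  have h4 := sum_half_pow_ite_le hH
  linarith

variable {L : ℕ} [NeZero L] {a b : ℕ} {Λ y z : Finset (Fin L)} {T : ℕ}

/-- The condition on `T` under which `T` is a lower bound for the distance from `y ∪ z` to the
droplets. In its first alternative `T` is at most the cost of `y` together with one more particle,
next to the interval on either side; in the second one `y` is a cluster at an end of the
interval. -/
def IsExponentBound (Λ y : Finset (Fin L)) (T : ℕ) : Prop :=
  ((T : ℤ) ≤ ∑ v ∈ Λ \ y, min (before y v : ℤ) (y.card + 1 - before y v) ∧
      (T : ℤ) ≤ ∑ v ∈ Λ \ y, min (before y v + 1 : ℤ) (y.card - before y v)) ∨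
    (T = 1 ∧ ((∀ v ∈ Λ \ y, before y v = 0) ∨ ∀ v ∈ Λ \ y, before y v = y.card))

theorem half_pow_dropletDist_le (hL : 3 ≤ L) (hab : a ≤ b) (hb : b + 1 < L)
    (hΛ : ∀ v, v ∈ Λ ↔ a ≤ v.val ∧ v.val ≤ b) (hy : y ⊆ Λ) (hz : z ⊆ Λᶜ)
    (hk : 1 ≤ z.card) (hkn : z.card < y.card) (hT : IsExponentBound Λ y T)
    (hH : 1 ≤ (Λ \ y).card) (hHm : 2 * (Λ \ y).card + z.card ≤ L - (b + 1 - a))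
    (hdrop : ¬ IsDroplet (y ∪ z)) :
    T ≤ dropletDist (y ∪ z) ∧ (1 / 2 : ℝ) ^ dropletDist (y ∪ z)
      ≤ (1 / 2) ^ T
        * cutBound (L - (b + 1 - a)) z.card (Λ \ y).card (z.image (indexAfter b)) := by
  set m := L - (b + 1 - a)
  set w := z.image (indexAfter b) with hw
  set H := (Λ \ y).card
  have hd1 : 1 ≤ dropletDist (y ∪ z) :=
    dropletDist_pos hL ((Finset.card_pos.1 (by omega : 0 < z.card)).mono
      Finset.subset_union_right) hdrop
  obtain ⟨σ, hσ1, hσ2, hσ⟩ :=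
    exists_sum_circDist_le_dropletDist hL hab hb hΛ hy hz (by omega)
  have hwc : w.card = z.card :=
    Finset.card_image_of_injective _ (indexAfter_injective (by omega))
  have hwm : w ⊆ Finset.range m := by
    rw [hw, ← image_indexAfter_compl hab hb hΛ]
    exact Finset.image_subset_image hz
  have hQ : (Finset.range m \ w).card = m - z.card := by
    rw [Finset.card_sdiff_of_subset hwm, hwc, Finset.card_range]
  have hl : ∀ j ∈ Finset.range m \ w, (w.filter (· < j)).card ≤ z.card := fun j _ =>
    (Finset.card_filter_le _ _).trans hwc.le
  have hℓ : ∀ v ∈ Λ \ y, before y v ≤ y.card := fun v _ => before_le_card y v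
  obtain ⟨i, rfl⟩ := Int.eq_ofNat_of_zero_le (by omega : 0 ≤ σ)
  have hrest : (0 : ℝ) ≤ (1 / 2) ^ (m - z.card - 2 * H) := by positivity
  rcases lt_or_ge i y.card with hi | hi
  · have h := le_of_cut_inside hkn hℓ hl hT hH (by omega) (by omega) hi hσ
    rw [hQ] at h
    refine ⟨by omega, ?_⟩
    calc (1 / 2 : ℝ) ^ dropletDist (y ∪ z)
        ≤ (1 / 2) ^ (T + (m - z.card - 2 * H)) :=
          pow_le_pow_of_le_one (by norm_num) (by norm_num) (by omega)
      _ = (1 / 2) ^ T * (1 / 2) ^ (m - z.card - 2 * H) := pow_add _ _ _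
      _ ≤ _ := by
          rw [cutBound]
          refine mul_le_mul_of_nonneg_left (le_add_of_nonneg_left ?_) (by positivity)
          positivity
  · obtain ⟨r, rfl⟩ := Nat.exists_eq_add_of_le hi
    push_cast at hσ hσ2
    have hr : r ≤ z.card := by omega
    obtain ⟨h1, h2⟩ := le_of_cut_outside hk hkn hℓ hl hT hr hd1 hσ
    refine ⟨h1, ?_⟩
    set c := if 1 ≤ r ∧ r < z.card ∧ 3 ≤ z.card then H else 0 with hc
    have h3 : (1 / 2 : ℝ) ^ (dropletDist (y ∪ z) + 1)
        ≤ (1 / 2) ^ (T + holeWeight (fun l => (l - r) + (r - l)) m w + c) :=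
      pow_le_pow_of_le_one (by norm_num) (by norm_num) h2
    have h4 : 2 * (1 / 2 : ℝ) ^ c * (1 / 2) ^ holeWeight (fun l => (l - r) + (r - l)) m w
        ≤ cutBound m z.card H w := by
      rw [cutBound]
      refine le_add_of_le_of_nonneg ?_ hrest
      exact Finset.single_le_sum (f := fun r =>
        2 * (1 / 2 : ℝ) ^ (if 1 ≤ r ∧ r < z.card ∧ 3 ≤ z.card then H else 0)
          * (1 / 2) ^ holeWeight (fun l => (l - r) + (r - l)) m w)
        (fun r _ => by positivity) (Finset.mem_range.2 (Nat.lt_succ_of_le hr))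
    calc (1 / 2 : ℝ) ^ dropletDist (y ∪ z)
        = 2 * (1 / 2 : ℝ) ^ (dropletDist (y ∪ z) + 1) := by rw [pow_succ]; ring
      _ ≤ 2 * (1 / 2) ^ (T + holeWeight (fun l => (l - r) + (r - l)) m w + c) := by gcongr
      _ = (1 / 2) ^ T * (2 * (1 / 2 : ℝ) ^ c
            * (1 / 2) ^ holeWeight (fun l => (l - r) + (r - l)) m w) := by
          rw [pow_add, pow_add]; ring
      _ ≤ _ := mul_le_mul_of_nonneg_left h4 (by positivity)

theorem sum_exp_dropletDist_le (hL : 3 ≤ L) (hab : a ≤ b) (hb : b + 1 < L)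
    (hΛ : ∀ v, v ∈ Λ ↔ a ≤ v.val ∧ v.val ≤ b) (hy : y ⊆ Λ) {k : ℕ}
    (hk : 1 ≤ k) (hkn : k < y.card) (hT : IsExponentBound Λ y T)
    (hH : k + 1 ≤ (Λ \ y).card)
    (hD : (L - (b + 1 - a)) + 32 * k ≤ 8 * ((L - (b + 1 - a)) - k - 2 * (Λ \ y).card))
    {μ : ℝ} (hμ : Real.log 2 ≤ μ) :
    ∑ z ∈ Λᶜ.powersetCard k with ¬ IsDroplet (y ∪ z), Real.exp (-μ * (dropletDist (y ∪ z) : ℝ))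
      ≤ Real.exp (-μ) ^ T * 129 := by
  set m := L - (b + 1 - a)
  set H := (Λ \ y).card
  have hinj : Function.Injective (indexAfter b : Fin L → ℕ) := indexAfter_injective (by omega)
  have hterm : ∀ z ∈ (Λᶜ.powersetCard k).filter (fun z => ¬ IsDroplet (y ∪ z)),
      Real.exp (-μ * (dropletDist (y ∪ z) : ℝ))
        ≤ Real.exp (-μ) ^ T * cutBound m k H (z.image (indexAfter b)) := by
    intro z hz
    obtain ⟨hz, hdrop⟩ := Finset.mem_filter.1 hz
    obtain ⟨hzΛ, rfl⟩ := Finset.mem_powersetCard.1 hz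
    obtain ⟨h1, h2⟩ := half_pow_dropletDist_le hL hab hb hΛ hy hzΛ hk hkn hT (by omega)
      (by omega) hdrop
    rw [exp_neg_mul_natCast_eq_pow]
    exact pow_le_pow_mul_of_half (Real.exp_nonneg _) (exp_neg_le_half hμ) h1 h2
  have himg : ((Λᶜ.powersetCard k).filter fun z => ¬ IsDroplet (y ∪ z)).image
      (Finset.image (indexAfter b)) ⊆ (Finset.range m).powersetCard k := by
    intro w hw
    obtain ⟨z, hz, rfl⟩ := Finset.mem_image.1 hw
    obtain ⟨hz, hzc⟩ := Finset.mem_powersetCard.1 (Finset.mem_filter.1 hz).1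
    rw [Finset.mem_powersetCard, Finset.card_image_of_injective _ hinj,
      ← image_indexAfter_compl hab hb hΛ]
    exact ⟨Finset.image_subset_image hz, hzc⟩
  refine (Finset.sum_le_sum hterm).trans ?_
  rw [← Finset.mul_sum]
  refine mul_le_mul_of_nonneg_left ?_ (by positivity)
  rw [← Finset.sum_image (f := cutBound m k H) (Finset.image_injective hinj).injOn]
  refine (Finset.sum_le_sum_of_subset_of_nonneg himg fun w _ _ => cutBound_nonneg m k H w).trans ?_
  exact sum_cutBound_le (hH.trans Nat.lt_two_pow_self.le) hD

end Summation

/-- The exponent `h + 1` of the claimed bound is at most an admissible lower bound for the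
distances. -/
theorem exists_isExponentBound {L : ℕ} [NeZero L] {θ : ℝ} {a b n : ℕ} (hL : 3 ≤ L) (ha : 0 < a)
    (hab : a ≤ b) (hb : b + 1 < L) (hmin : (sectorMin L θ).val = a)
    (hmax : (sectorMax L θ).val = b) (hΛ : ∀ v, v ∈ sector L θ ↔ a ≤ v.val ∧ v.val ≤ b)
    {y : Finset (Fin L)} (hy : y ⊆ sector L θ) (hn : y.card = n) :
    ∃ T : ℕ, IsExponentBound (sector L θ) y T ∧ hFun L θ n y + 1 ≤ T := by
  have hyc := Finset.card_le_card hy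
  rw [card_interval hab hb hΛ, hn] at hyc
  by_cases hcl : y = rightCluster L θ n ∨ y = leftCluster L θ n
  · refine ⟨1, Or.inr ⟨rfl, ?_⟩, by simp [hFun, hcl]⟩
    rcases hcl with hcl | hcl
    · left
      intro v hv
      obtain ⟨hv, hvy⟩ := Finset.mem_sdiff.1 hv
      rw [hcl, mem_rightCluster_iff hmax (by omega)] at hvy
      have := (hΛ v).1 hv
      rw [before, Finset.card_eq_zero, Finset.filter_eq_empty_iff]
      intro u hu
      rw [hcl, mem_rightCluster_iff hmax (by omega)] at hu
      rw [Fin.lt_def]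
      omega
    · right
      intro v hv
      obtain ⟨hv, hvy⟩ := Finset.mem_sdiff.1 hv
      rw [hcl, mem_leftCluster_iff hmin (by omega)] at hvy
      have := (hΛ v).1 hv
      rw [before, Finset.filter_true_of_mem]
      intro u hu
      rw [hcl, mem_leftCluster_iff hmin (by omega)] at hu
      rw [Fin.lt_def]
      omega
  · have hr : (rightSite L θ).val = b + 1 := by
      have := val_site (L := L) (j := ((sectorMax L θ).val : ℤ) + 1) (by omega) (by omega)
      rw [rightSite]
      omega
    have hl : (leftSite L θ).val + 1 = a := by
      have := val_site (L := L) (j := ((sectorMin L θ).val : ℤ) - 1) (by omega) (by omega)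
      rw [leftSite]
      omega
    have h1 := dropletDist_union_right_le hL hab hb hΛ hy hr
    have h2 := dropletDist_union_left_le hL hab hb hΛ hy hl
    refine ⟨min (dropletDist (y ∪ {rightSite L θ})) (dropletDist (y ∪ {leftSite L θ})),
      Or.inl ⟨le_trans ?_ h1, le_trans ?_ h2⟩, ?_⟩
    · exact_mod_cast min_le_left _ _
    · exact_mod_cast min_le_right _ _
    · rw [hFun, if_neg hcl, sub_add_cancel, Nat.cast_min]
      exact min_le_left _ _

theorem mainTheorem1 (ε : ℝ) (hε : 0 < ε) (hε' : ε < 1 / 16) :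
    ∃ L₀ : ℕ, 0 < L₀ ∧
      ∀ θ : ℝ, ε < θ → θ < 1 / 16 →
      ∀ (L : ℕ) [NeZero L], L₀ ≤ L →
      ∀ N : ℕ, N = ⌊ε * (L : ℝ)⌋₊ →
      ∀ n : ℕ, (N : ℝ) / 2 < n → n < N →
      ∀ y ∈ (sector L θ).powersetCard n,
      ∀ μ : ℝ, Real.log 2 ≤ μ →
        ∑ z ∈ (sector L θ)ᶜ.powersetCard (N - n) with ¬ IsDroplet (y ∪ z),
            Real.exp (-μ * (dropletDist (y ∪ z) : ℝ))
          ≤ 333 * Real.exp (-μ) * Real.exp (-μ * hFun L θ n y) := by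
  -- The existence of `n` with `N / 2 < n < N` forces `2 ≤ N`, hence `32 < L`, which is all that is
  -- needed.
  refine ⟨1, one_pos, ?_⟩
  intro θ hεθ hθ L _ _ N hN n hNn hnN y hy μ hμ
  obtain ⟨hy, hyn⟩ := Finset.mem_powersetCard.1 hy
  have hL0 : (0 : ℝ) < L := by exact_mod_cast Nat.pos_of_ne_zero (NeZero.ne L)
  have hNε : (N : ℝ) ≤ ε * L := by
    rw [hN]
    exact Nat.floor_le (by positivity)
  have hN2n : N < 2 * n := by
    have : (N : ℝ) < 2 * n := by linarith
    exact_mod_cast this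
  have hNθ : (N : ℝ) < θ * L := by nlinarith
  have hθL : 16 * (θ * L) < L := by nlinarith
  have h16N : 16 * N < L := by
    have : 16 * (N : ℝ) < L := by linarith
    exact_mod_cast this
  obtain ⟨a, b, ha, hab, hb, hmin, hmax, hΛ, hlow, hupp⟩ :=
    exists_sector_eq_interval (L := L) (by omega) (hε.trans hεθ) hθ
  have hlow' : 2 * N + a < b + 2 := by
    have : 2 * (N : ℝ) + a < b + 2 := by linarith
    exact_mod_cast this
  have hupp' : 8 * b < 8 * a + L := by
    have : 8 * (b : ℝ) < 8 * a + L := by linarith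
    exact_mod_cast this
  have hH : (sector L θ \ y).card = b + 1 - a - n := by
    rw [Finset.card_sdiff_of_subset hy, card_interval hab hb hΛ, hyn]
  obtain ⟨T, hT, hTh⟩ := exists_isExponentBound (by omega) ha hab hb hmin hmax hΛ hy hyn
  have hsum := sum_exp_dropletDist_le (k := N - n) (by omega) hab hb hΛ hy (by omega) (by omega)
    hT (by omega) (by omega) hμ
  refine hsum.trans ?_
  have hμ0 : 0 ≤ μ := (Real.log_nonneg (by norm_num)).trans hμ
  have hexp : Real.exp (-μ) ^ T ≤ Real.exp (-μ) * Real.exp (-μ * hFun L θ n y) := by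
    rw [← exp_neg_mul_natCast_eq_pow, ← Real.exp_add, Real.exp_le_exp]
    nlinarith
  have h0 : 0 ≤ Real.exp (-μ) * Real.exp (-μ * hFun L θ n y) := by positivity
  linarith
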